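/- An $\omega$-Lie algebra over $\mathbb{C}$ is a complex vector space $\mathfrak g$ with a skew-symmetric bilinear bracket $[\cdot,\cdot]:\mathfrak g\times\mathfrak g\to\mathfrak g$ and a skew-symmetric bilinear form $\omega:\mathfrak g\times\mathfrak g\to\mathbb C$ such that $$[[x,y],z]+[[y,z],x]+[[z,x],y]=\omega(x,y)z+\omega(y,z)x+\omega(z,x)y\qquad(x,y,z\in\mathfrak g).$$ It is simple if its bracket is not identically zero and its only ideals (subspaces $I$ with $[I,\mathfrak g]\subseteq I$) are $0$ and $\mathfrak g$. A linear map $D:\mathfrak g\to\mathfrak g$ is a $\frac12$-derivation if $D([x,y])=\frac12([D(x),y]+[x,D(y)])$ for all $x,y\in\mathfrak g$. A linear map $f:\mathfrak g\to\mathfrak g$ is a local $\frac12$-derivation if for every $x\in\mathfrak g$ there is a $\frac12$-derivation $D_x$ of $\mathfrak g$ with $f(x)=D_x(x)$. For $\alpha\in\mathbb C$ let $C_\alpha$ be the three-dimensional $\omega$-Lie algebra with basis $e_1,e_2,e_3$ and $[e_1,e_2]=e_2$, $[e_1,e_3]=\alpha e_3$, $[e_2,e_3]=e_1$, $\omega(e_1,e_2)=\omega(e_1,e_3)=0$,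 $\omega(e_2,e_3)=1+\alpha$. **Theorem.** Let $\mathfrak g$ be a finite-dimensional simple $\omega$-Lie algebra over $\mathbb C$. Then every local $\frac12$-derivation $f$ of $\mathfrak g$ is a $\frac12$-derivation. Moreover, $f$ is a scalar multiple of the identity unless $\mathfrak g$ is isomorphic (by a linear bijection preserving $[\cdot,\cdot]$ and $\omega$) to $C_\alpha$ for some $\alpha\in\{2,\tfrac12,-4,-\tfrac14\}$. -/

import Mathlib

/-- A complex `ω`-Lie algebra structure on a complex vector space `V`: a skew-symmetric bilinear
bracket and a skew-symmetric bilinear form `ω` satisfying the `ω`-Jacobi identity. -/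
structure OmegaLieAlgebra (V : Type*) [AddCommGroup V] [Module ℂ V] where
  bracket : V →ₗ[ℂ] V →ₗ[ℂ] V
  omega : V →ₗ[ℂ] V →ₗ[ℂ] ℂ
  bracket_skew : ∀ x y, bracket x y = -bracket y x
  omega_skew : ∀ x y, omega x y = -omega y x
  jacobi : ∀ x y z,
    bracket (bracket x y) z + bracket (bracket y z) x + bracket (bracket z x) y
      = omega x y • z + omega y z • x + omega z x • y

namespace OmegaLieAlgebra

variable {V W : Type*} [AddCommGroup V] [Module ℂ V] [AddCommGroup W] [Module ℂ W]

/-- A subspace `I` with `[I, V] ⊆ I`; by skew-symmetry it is a two-sided ideal. -/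
def IsIdeal (L : OmegaLieAlgebra V) (I : Submodule ℂ V) : Prop :=
  ∀ x ∈ I, ∀ y, L.bracket x y ∈ I

/-- Simple: the bracket is not identically zero and there are no ideals except `0` and `V`. -/
def IsSimple (L : OmegaLieAlgebra V) : Prop :=
  (∃ x y, L.bracket x y ≠ 0) ∧ ∀ I : Submodule ℂ V, L.IsIdeal I → I = ⊥ ∨ I = ⊤

/-- A linear map `D` with `D [x, y] = ½ ([D x, y] + [x, D y])`. -/
def IsHalfDerivation (L : OmegaLieAlgebra V) (D : V →ₗ[ℂ] V) : Prop :=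
  ∀ x y, D (L.bracket x y) = (1 / 2 : ℂ) • (L.bracket (D x) y + L.bracket x (D y))

/-- A linear map that agrees at each point with some `½`-derivation, depending on the point. -/
def IsLocalHalfDerivation (L : OmegaLieAlgebra V) (f : V →ₗ[ℂ] V) : Prop :=
  ∀ x, ∃ D : V →ₗ[ℂ] V, L.IsHalfDerivation D ∧ f x = D x

/-- Isomorphism of `ω`-Lie algebras. -/
def Isomorphic (L : OmegaLieAlgebra V) (M : OmegaLieAlgebra W) : Prop :=
  ∃ e : V ≃ₗ[ℂ] W, (∀ x y, e (L.bracket x y) = M.bracket (e x) (e y)) ∧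
    ∀ x y, L.omega x y = M.omega (e x) (e y)

/-- The three-dimensional `ω`-Lie algebra `C_α`: in the standard basis `e₁, e₂, e₃` (here with
indices `0, 1, 2`), `[e₁, e₂] = e₂`, `[e₁, e₃] = α e₃`, `[e₂, e₃] = e₁`,
`ω(e₁, e₂) = ω(e₁, e₃) = 0`, `ω(e₂, e₃) = 1 + α`. -/
def algC (α : ℂ) : OmegaLieAlgebra (Fin 3 → ℂ) where
  bracket := LinearMap.mk₂ ℂ
    (fun x y => ![x 1 * y 2 - x 2 * y 1, x 0 * y 1 - x 1 * y 0, α * (x 0 * y 2 - x 2 * y 0)])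
    (by intro x x' y; ext i; fin_cases i <;> simp <;> ring)
    (by intro c x y; ext i; fin_cases i <;> simp <;> ring)
    (by intro x y y'; ext i; fin_cases i <;> simp <;> ring)
    (by intro c x y; ext i; fin_cases i <;> simp <;> ring)
  omega := LinearMap.mk₂ ℂ (fun x y => (1 + α) * (x 1 * y 2 - x 2 * y 1))
    (by intro x x' y; simp; ring)
    (by intro c x y; simp; ring)
    (by intro x y y'; simp; ring)
    (by intro c x y; simp; ring)
  bracket_skew := by intro x y; ext i; fin_cases i <;> simp <;> ring
  omega_skew := by intro x y; simp; ring
  jacobi := by intro x y z; ext i; fin_cases i <;> simp <;> ring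

end OmegaLieAlgebra

namespace OmegaLieAlgebra

variable {V W : Type*} [AddCommGroup V] [Module ℂ V] [AddCommGroup W] [Module ℂ W]

/-! A ½-derivation `D` sends brackets to midpoints: `[V_μ, V_ν] ⊆ V_{(μ+ν)/2}` for its generalized
eigenspaces. An eigenvalue `c` of maximal modulus is an extreme point of a disc containing the
spectrum, so the sum of the other `V_μ` is a proper ideal, hence zero, and `D = c + N` with `N` a
nilpotent ½-derivation. Everything turns on whether some such `N` is nonzero. If none is, every
½-derivation is scalar, each vector is an eigenvector of `f`, and `f` is scalar.

If `ω = 0`, the algebra is a simple Lie algebra. There `N` is self-adjoint for the Killing form,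
which forces `[N x, y] = [x, N y]`; then `ker N` is a nonzero ideal and `N = 0`
(`IsHalfDerivation.eq_zero_of_isNilpotent`).

If `ω ≠ 0`, the dimension is three (`IsSimple.finrank_le_three`, `IsSimple.three_le_finrank`).
Outside dimension two, `ω = lam ∘ [·,·]` for a linear form `lam`, and the Jacobi identity yields `ω
∧ ω = 0`. So the radical of `ω` has codimension two, and its action on the quotient by 2 × 2
matrices produces a proper nonzero ideal as soon as the dimension exceeds three.

In dimension three the Jordan type of `N ≠ 0` and simplicity determine the algebra: `N² ≠ 0` gives
`C_{-1/4}`, `N² = 0` gives `C_{1/2}`. The values `-4` and `2` add nothing, since `C_α ≅ C_{1/α}`.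
For these two algebras the ½-derivations form an explicit two-parameter family, and testing `f` on a
few vectors shows that it belongs to it. -/

/-! ### Spectrum of a ½-derivation -/

theorem isHalfDerivation_id (L : OmegaLieAlgebra V) : L.IsHalfDerivation LinearMap.id := by
  intro x y
  simp only [LinearMap.id_apply]
  module

theorem IsHalfDerivation.add {L : OmegaLieAlgebra V} {D E : V →ₗ[ℂ] V}
    (hD : L.IsHalfDerivation D) (hE : L.IsHalfDerivation E) : L.IsHalfDerivation (D + E) := by
  intro x y
  simp only [LinearMap.add_apply, map_add, hD x y, hE x y]
  module

theorem IsHalfDerivation.smul {L : OmegaLieAlgebra V} {D : V →ₗ[ℂ] V}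
    (hD : L.IsHalfDerivation D) (c : ℂ) : L.IsHalfDerivation (c • D) := by
  intro x y
  simp only [LinearMap.smul_apply, map_smul, hD x y]
  module

theorem IsHalfDerivation.sub_smul_one {L : OmegaLieAlgebra V} {D : V →ₗ[ℂ] V}
    (hD : L.IsHalfDerivation D) (c : ℂ) :
    L.IsHalfDerivation (D - c • (1 : Module.End ℂ V)) := by
  have := hD.add ((isHalfDerivation_id L).smul (-c))
  convert this using 1
  ext x
  simp [sub_eq_add_neg]

/-- The bracket of generalized eigenvectors of a `½`-derivation is a generalized eigenvector at
the midpoint of the eigenvalues. -/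
theorem IsHalfDerivation.pow_bracket_eq_zero {L : OmegaLieAlgebra V} {D : Module.End ℂ V}
    (hD : L.IsHalfDerivation D) (μ ν : ℂ) (n : ℕ) : ∀ (a b : ℕ) (x y : V), a + b = n →
      ((D - μ • (1 : Module.End ℂ V)) ^ a) x = 0 → ((D - ν • (1 : Module.End ℂ V)) ^ b) y = 0 →
      ((D - ((μ + ν) / 2) • (1 : Module.End ℂ V)) ^ n) (L.bracket x y) = 0 := by
  induction n with
  | zero =>
    intro a b x y hab hx hy
    obtain rfl : a = 0 := by omega
    have : x = 0 := by simpa using hx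
    simp [this]
  | succ n ih =>
    intro a b x y hab hx hy
    rcases a with _ | a
    · have : x = 0 := by simpa using hx
      simp [this]
    rcases b with _ | b
    · have : y = 0 := by simpa using hy
      simp [this]
    have key : (D - ((μ + ν) / 2) • (1 : Module.End ℂ V)) (L.bracket x y)
        = (1 / 2 : ℂ) • (L.bracket ((D - μ • (1 : Module.End ℂ V)) x) y
          + L.bracket x ((D - ν • (1 : Module.End ℂ V)) y)) := by
      simp only [LinearMap.sub_apply, LinearMap.smul_apply, Module.End.one_apply, map_sub,
        map_smul, hD x y]
      module
    rw [pow_succ, Module.End.mul_apply, key, map_smul, map_add,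
      ih a (b + 1) _ _ (by omega) (by rwa [pow_succ, Module.End.mul_apply] at hx) hy,
      ih (a + 1) b _ _ (by omega) hx (by rwa [pow_succ, Module.End.mul_apply] at hy)]
    simp

theorem IsHalfDerivation.bracket_mem_maxGenEigenspace {L : OmegaLieAlgebra V}
    {D : Module.End ℂ V} (hD : L.IsHalfDerivation D) {μ ν : ℂ} {x y : V}
    (hx : x ∈ D.maxGenEigenspace μ) (hy : y ∈ D.maxGenEigenspace ν) :
    L.bracket x y ∈ D.maxGenEigenspace ((μ + ν) / 2) := by
  rw [Module.End.mem_maxGenEigenspace] at hx hy ⊢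
  obtain ⟨a, ha⟩ := hx
  obtain ⟨b, hb⟩ := hy
  exact ⟨a + b, hD.pow_bracket_eq_zero μ ν _ a b x y rfl ha hb⟩

/-- Strict convexity of the disc, through the parallelogram law. -/
theorem eq_of_midpoint_of_norm_le {a b c : ℂ} (ha : ‖a‖ ≤ ‖c‖) (hb : ‖b‖ ≤ ‖c‖)
    (h : (a + b) / 2 = c) : a = c := by
  have h2 : a + b = 2 * c := by rw [← h]; ring
  have hp := parallelogram_law_with_norm ℝ a b
  rw [h2, norm_mul, Complex.norm_ofNat] at hp
  have h0 : ‖a - b‖ = 0 := by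
    have := norm_nonneg a
    have := norm_nonneg b
    have := norm_nonneg (a - b)
    nlinarith
  have hab : a = b := sub_eq_zero.mp (norm_eq_zero.mp h0)
  rw [← h, ← hab]
  ring

/-- A `½`-derivation of a simple `ω`-Lie algebra has only one eigenvalue. -/
theorem IsHalfDerivation.exists_isNilpotent_sub [FiniteDimensional ℂ V] {L : OmegaLieAlgebra V}
    (hL : L.IsSimple) {D : Module.End ℂ V} (hD : L.IsHalfDerivation D) :
    ∃ c : ℂ, IsNilpotent (D - c • (1 : Module.End ℂ V)) := by
  have hnt : Nontrivial V := by
    obtain ⟨x, y, hxy⟩ := hL.1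
    exact ⟨⟨_, _, hxy⟩⟩
  have hfin : {μ : ℂ | D.HasEigenvalue μ}.Finite := Module.End.finite_hasEigenvalue D
  obtain ⟨c, hc, hmax⟩ := Set.exists_max_image _ (fun μ : ℂ => ‖μ‖) hfin
    (Module.End.exists_eigenvalue D)
  have heig : ∀ {μ : ℂ} {x : V}, x ∈ D.maxGenEigenspace μ → x ≠ 0 → D.HasEigenvalue μ := by
    intro μ x hx hx0
    by_contra hμ
    have hbot : D.maxGenEigenspace μ = ⊥ := by
      by_contra hne
      exact hμ ((Module.End.hasUnifEigenvalue_iff_hasUnifEigenvalue_one (k := ⊤) (by simp)).mp hne)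
    rw [hbot] at hx
    exact hx0 (by simpa using hx)
  have htop : ⨆ μ : ℂ, D.maxGenEigenspace μ = ⊤ := Module.End.iSup_maxGenEigenspace_eq_top D
  have hind := Module.End.independent_maxGenEigenspace D
  have hideal : L.IsIdeal (⨆ μ : ℂ, ⨆ _ : μ ≠ c, D.maxGenEigenspace μ) := by
    intro x hx y
    have hy : y ∈ ⨆ μ : ℂ, D.maxGenEigenspace μ := htop ▸ Submodule.mem_top
    refine Submodule.iSup_induction _ (motive := fun y => L.bracket x y ∈ _) hy ?_ ?_ ?_
    · intro ν y hy
      refine Submodule.iSup_induction _ (motive := fun x => L.bracket x y ∈ _) hx ?_ ?_ ?_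
      · intro μ x hx
        by_cases hx0 : x = 0
        · simp [hx0]
        by_cases hy0 : y = 0
        · simp [hy0]
        by_cases hμ : μ = c
        · simp only [hμ, ne_eq, not_true_eq_false, iSup_false, Submodule.mem_bot] at hx
          exact absurd hx hx0
        simp only [ne_eq, hμ, not_false_eq_true, iSup_pos] at hx
        have hne : (μ + ν) / 2 ≠ c := fun h =>
          hμ (eq_of_midpoint_of_norm_le (hmax _ (heig hx hx0)) (hmax _ (heig hy hy0)) h)
        exact Submodule.mem_iSup_of_mem _
          (Submodule.mem_iSup_of_mem hne (hD.bracket_mem_maxGenEigenspace hx hy))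
      · simp
      · intro x x' h h'
        rw [map_add, LinearMap.add_apply]
        exact add_mem h h'
    · simp
    · intro y y' h h'
      rw [map_add]
      exact add_mem h h'
  have hbot : D.maxGenEigenspace c ≠ ⊥ := by
    obtain ⟨v, hv⟩ := hc.exists_hasEigenvector
    intro h
    apply hv.2
    have : v ∈ D.maxGenEigenspace c := by
      rw [Module.End.mem_maxGenEigenspace]
      exact ⟨1, by simp [hv.apply_eq_smul]⟩
    rw [h] at this
    simpa using this
  have hM : (⨆ μ : ℂ, ⨆ _ : μ ≠ c, D.maxGenEigenspace μ) = ⊥ := by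
    refine (hL.2 _ hideal).resolve_right fun h => hbot ?_
    have := hind c
    rw [h] at this
    simpa using this
  have hc_top : D.maxGenEigenspace c = ⊤ := by
    rw [← htop]
    refine le_antisymm (le_iSup _ c) (iSup_le fun μ => ?_)
    by_cases hμ : μ = c
    · rw [hμ]
    · refine le_trans (le_trans ?_ hM.le) bot_le
      exact le_iSup_of_le μ (le_iSup_of_le hμ le_rfl)
  refine ⟨c, Module.finrank ℂ V, ?_⟩
  ext v
  have hv : v ∈ D.maxGenEigenspace c := hc_top ▸ Submodule.mem_top
  rw [Module.End.maxGenEigenspace_eq_genEigenspace_finrank] at hv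
  simpa using Module.End.mem_genEigenspace_nat.mp hv

/-! ### The case `ω = 0`: simple Lie algebras and the Killing form -/

theorem bracket_self (L : OmegaLieAlgebra V) (x : V) : L.bracket x x = 0 := by
  have h := L.bracket_skew x x
  have h2 : (2 : ℂ) • L.bracket x x = 0 := by
    rw [two_smul]; nth_rewrite 1 [h]; simp
  simpa using h2

theorem omega_self (L : OmegaLieAlgebra V) (x : V) : L.omega x x = 0 := by
  have h := L.omega_skew x x
  linear_combination h / 2

/-- The Lie ring attached to an `ω`-Lie algebra with `ω = 0`. -/
abbrev toLieRing (L : OmegaLieAlgebra V) (h0 : L.omega = 0) : LieRing V :=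
  { (inferInstance : AddCommGroup V) with
    bracket := fun x y => L.bracket x y
    add_lie := fun x y z => by
      change L.bracket (x + y) z = L.bracket x z + L.bracket y z
      simp
    lie_add := fun x y z => by
      change L.bracket x (y + z) = L.bracket x y + L.bracket x z
      simp
    lie_self := fun x => L.bracket_self x
    leibniz_lie := fun x y z => by
      change L.bracket x (L.bracket y z)
        = L.bracket (L.bracket x y) z + L.bracket y (L.bracket x z)
      have hj := L.jacobi x y z
      rw [L.bracket_skew (L.bracket y z) x, L.bracket_skew (L.bracket z x) y,
        L.bracket_skew z x] at hj
      simp only [h0, LinearMap.zero_apply, zero_smul, add_zero, map_neg, neg_neg] at hj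
      rw [← sub_eq_zero, ← neg_eq_zero, ← hj]
      abel }

/-- The Lie algebra attached to an `ω`-Lie algebra with `ω = 0`. -/
abbrev toLieAlgebra (L : OmegaLieAlgebra V) (h0 : L.omega = 0) :
    @LieAlgebra ℂ V _ (L.toLieRing h0) :=
  letI := L.toLieRing h0
  { (inferInstance : Module ℂ V) with
    lie_smul := fun c x y => by
      change L.bracket x (c • y) = c • L.bracket x y
      simp }

/-- Nondegeneracy of the Killing form of a simple Lie algebra in characteristic zero. -/
theorem IsSimple.eq_zero_of_trace_eq_zero [FiniteDimensional ℂ V] {L : OmegaLieAlgebra V}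
    (hL : L.IsSimple) (h0 : L.omega = 0) {x : V}
    (hx : ∀ y, LinearMap.trace ℂ V (L.bracket x ∘ₗ L.bracket y) = 0) : x = 0 := by
  let _ := L.toLieRing h0
  let _ := L.toLieAlgebra h0
  have hsimple : LieAlgebra.IsSimple ℂ V :=
    { eq_bot_or_eq_top := fun I => by
        have hI : L.IsIdeal (I : Submodule ℂ V) := by
          intro a ha b
          rw [L.bracket_skew]
          exact neg_mem (I.lie_mem (x := b) ha)
        rcases hL.2 _ hI with h | h
        · left; exact LieSubmodule.toSubmodule_injective (by simpa using h)
        · right; exact LieSubmodule.toSubmodule_injective (by simpa using h)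
      non_abelian := fun h => by
        obtain ⟨a, b, hab⟩ := hL.1
        exact hab (h.trivial a b) }
  have hK : LieAlgebra.IsKilling ℂ V := inferInstance
  have hmem : x ∈ LieIdeal.killingCompl ℂ V ⊤ := by
    rw [LieIdeal.mem_killingCompl]
    intro y _
    rw [killingForm_apply_apply, LinearMap.trace_comp_comm']
    exact hx y
  rw [LieAlgebra.IsKilling.killingCompl_top_eq_bot] at hmem
  simpa using hmem

theorem jacobi_operator (L : OmegaLieAlgebra V) (x y z : V) :
    L.bracket (L.bracket x y) z = L.bracket x (L.bracket y z) - L.bracket y (L.bracket x z)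
      + (L.omega x y • z + L.omega y z • x - L.omega x z • y) := by
  have hj := L.jacobi x y z
  rw [L.bracket_skew (L.bracket y z) x, L.bracket_skew (L.bracket z x) y,
    L.bracket_skew z x, L.omega_skew z x] at hj
  simp only [map_neg, neg_neg] at hj
  linear_combination (norm := module) hj

/-- A nilpotent `½`-derivation of a simple Lie algebra vanishes. -/
theorem IsHalfDerivation.eq_zero_of_isNilpotent [FiniteDimensional ℂ V] {L : OmegaLieAlgebra V}
    (hL : L.IsSimple) (h0 : L.omega = 0) {N : Module.End ℂ V} (hN : L.IsHalfDerivation N)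
    (hnil : IsNilpotent N) : N = 0 := by
  have hjac : ∀ x y z, L.bracket (L.bracket x y) z
      = L.bracket x (L.bracket y z) - L.bracket y (L.bracket x z) := by
    intro x y z
    simpa [h0] using L.jacobi_operator x y z
  have hN2 : ∀ x y, (2 : ℂ) • N (L.bracket x y) = L.bracket (N x) y + L.bracket x (N y) := by
    intro x y
    rw [hN x y]
    module
  -- Expand `4 N [[x, y], z]` on both sides of the Jacobi identity. The innermost slots carry weight
  -- 1 and the outer ones weight 2; subtracting the Jacobi identities with `N` in one slot leaves
  -- only the outer terms.
  have hop : ∀ x y z, L.bracket (L.bracket x y) (N z)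
      = L.bracket (N x) (L.bracket y z) - L.bracket (N y) (L.bracket x z) := by
    intro x y z
    have e1 := hjac (N x) y z
    have e2 := hjac x (N y) z
    have e3 := hjac x y (N z)
    have e4 := congrArg N (hjac x y z)
    have e5 := hN2 (L.bracket x y) z
    have e6 := hN2 x (L.bracket y z)
    have e7 := hN2 y (L.bracket x z)
    have e8 := congrArg (fun v => L.bracket v z) (hN2 x y)
    have e9 := congrArg (L.bracket x) (hN2 y z)
    have e10 := congrArg (L.bracket y) (hN2 x z)
    simp only [map_sub, map_add, map_smul, LinearMap.add_apply, LinearMap.smul_apply]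
      at e1 e2 e3 e4 e5 e6 e7 e8 e9 e10
    linear_combination (norm := module) (4 : ℂ) • e4 - (2 : ℂ) • e5 + (2 : ℂ) • e6 - (2 : ℂ) • e7 - e8 + e9
      - e10 - e1 - e2 - e3
  have htr0 : ∀ x y, LinearMap.trace ℂ V (L.bracket (L.bracket x y)) = 0 := by
    intro x y
    have : L.bracket (L.bracket x y)
        = L.bracket x * L.bracket y - L.bracket y * L.bracket x := by
      ext z; exact hjac x y z
    rw [this, map_sub, LinearMap.trace_mul_comm, sub_self]
  have htrN : ∀ x, LinearMap.trace ℂ V (L.bracket x * N) = LinearMap.trace ℂ V (L.bracket (N x)) := by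
    intro x
    have h : L.bracket (N x) = (2 : ℂ) • (N * L.bracket x) - L.bracket x * N := by
      ext y
      have := hN2 x y
      simp only [LinearMap.sub_apply, LinearMap.smul_apply, Module.End.mul_apply]
      rw [this]; abel
    rw [h, map_sub, map_smul, LinearMap.trace_mul_comm ℂ N, smul_eq_mul]
    ring
  -- Self-adjointness of `N` for the Killing form: the trace of `hop` is the trace of `ad (N [x,
  -- y])`, which vanishes because `N [x, y]` is a combination of brackets.
  have hself : ∀ x y, LinearMap.trace ℂ V (L.bracket (N x) * L.bracket y)
      = LinearMap.trace ℂ V (L.bracket (N y) * L.bracket x) := by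
    intro x y
    have h : L.bracket (L.bracket x y) * N
        = L.bracket (N x) * L.bracket y - L.bracket (N y) * L.bracket x := by
      ext z; exact hop x y z
    have h1 := htrN (L.bracket x y)
    rw [h, map_sub, hN x y, map_smul, map_smul, map_add, map_add, htr0, htr0] at h1
    simpa [sub_eq_zero] using h1
  have hinv : ∀ x y z, LinearMap.trace ℂ V (L.bracket (L.bracket x y) * L.bracket z)
      = LinearMap.trace ℂ V (L.bracket x * L.bracket (L.bracket y z)) := by
    intro x y z
    have h1 : L.bracket (L.bracket x y)
        = L.bracket x * L.bracket y - L.bracket y * L.bracket x := by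
      ext z; exact hjac x y z
    have h2 : L.bracket (L.bracket y z)
        = L.bracket y * L.bracket z - L.bracket z * L.bracket y := by
      ext w; exact hjac y z w
    rw [h1, h2, sub_mul, mul_sub, map_sub, map_sub, mul_assoc, mul_assoc,
      LinearMap.trace_mul_comm ℂ (L.bracket y), mul_assoc]
  -- The adjoint of the ½-derivation rule, by self-adjointness and invariance, reads `2 [y, N z] = N
  -- [y, z] + [N y, z]`; together with the rule itself it gives the claim.
  have hcent : ∀ y z, L.bracket y (N z) = L.bracket (N y) z := by
    intro y z
    have : (2 : ℂ) • L.bracket y (N z) - N (L.bracket y z) - L.bracket (N y) z = 0 := by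
      refine hL.eq_zero_of_trace_eq_zero h0 fun x => ?_
      change LinearMap.trace ℂ V (_ * L.bracket x) = 0
      rw [LinearMap.trace_mul_comm]
      simp only [map_sub, map_smul, mul_sub, mul_smul_comm]
      have t1 : LinearMap.trace ℂ V (L.bracket x * L.bracket (L.bracket y (N z)))
          = LinearMap.trace ℂ V (L.bracket (N (L.bracket x y)) * L.bracket z) := by
        rw [← hinv, LinearMap.trace_mul_comm, hself]
      have t2 : LinearMap.trace ℂ V (L.bracket x * L.bracket (N (L.bracket y z)))
          = LinearMap.trace ℂ V (L.bracket (L.bracket (N x) y) * L.bracket z) := by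
        rw [LinearMap.trace_mul_comm, hself, hinv]
      rw [t1, t2, ← hinv x (N y) z, hN x y]
      simp only [map_smul, map_add, add_mul, smul_mul_assoc, smul_eq_mul]
      ring
    have h2 := hN y z
    rw [h2] at this
    have h3 : (3 / 2 : ℂ) • (L.bracket y (N z) - L.bracket (N y) z) = 0 := by
      rw [← this]; module
    rw [smul_eq_zero] at h3
    exact sub_eq_zero.mp (h3.resolve_left (by norm_num))
  have hker : L.IsIdeal (LinearMap.ker N) := by
    intro x hx y
    rw [LinearMap.mem_ker] at hx ⊢
    rw [hN x y, hcent, hx]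
    simp
  rcases hL.2 _ hker with h | h
  · exfalso
    obtain ⟨k, hk⟩ := hnil
    have hinj : Function.Injective N := LinearMap.ker_eq_bot.mp h
    obtain ⟨x, y, hxy⟩ := hL.1
    have : (N ^ k) (L.bracket x y) = (N ^ k) 0 := by rw [hk]; simp
    rw [Module.End.coe_pow] at this
    exact hxy (hinj.iterate k this)
  · exact LinearMap.ker_eq_top.mp h

/-! ### `ω` as a function of the bracket, and its rank -/

/-- Away from dimension two, `ω` factors through the bracket. -/
theorem exists_omega_eq_apply_bracket [FiniteDimensional ℂ V] (L : OmegaLieAlgebra V)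
    (hn : Module.finrank ℂ V ≠ 2) :
    ∃ lam : V →ₗ[ℂ] ℂ, ∀ x y, L.omega x y = lam (L.bracket x y) := by
  have hn' : (Module.finrank ℂ V : ℂ) - 2 ≠ 0 := by
    rw [sub_ne_zero]; exact_mod_cast hn
  -- The trace of the Jacobi identity in `z` is `tr ad [x, y] = (n - 2) ω(x, y)`: the scalar term
  -- contributes `n`, the two rank-one terms `-1` each.
  refine ⟨((Module.finrank ℂ V : ℂ) - 2)⁻¹ • (LinearMap.trace ℂ V ∘ₗ L.bracket), fun x y => ?_⟩
  have h : L.bracket (L.bracket x y) = L.bracket x * L.bracket y - L.bracket y * L.bracket x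
      + (L.omega x y • (1 : Module.End ℂ V) + (L.omega y).smulRight x
        - (L.omega x).smulRight y) := by
    ext z
    simpa using L.jacobi_operator x y z
  have ht := congrArg (LinearMap.trace ℂ V) h
  rw [map_add, map_sub, map_sub, map_add, LinearMap.trace_mul_comm, map_smul,
    LinearMap.trace_one, LinearMap.trace_smulRight, LinearMap.trace_smulRight,
    L.omega_skew y x] at ht
  rw [LinearMap.smul_apply, LinearMap.comp_apply, ht, smul_eq_mul, smul_eq_mul]
  field_simp
  ring

theorem jacobi_ordered (L : OmegaLieAlgebra V) (x y z : V) :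
    L.bracket (L.bracket x y) z - L.bracket (L.bracket x z) y + L.bracket (L.bracket y z) x
      = L.omega x y • z + L.omega y z • x - L.omega x z • y := by
  have hj := L.jacobi x y z
  rw [L.bracket_skew z x, L.omega_skew z x, map_neg, LinearMap.neg_apply] at hj
  linear_combination (norm := module) hj

/-- Compute the alternating sum of the triple brackets `[[[a, b], c], e]` in two ways: with the
Jacobi identity inside the outer bracket (`j`), and with it applied to `[a, b], c, e` (`i`). The
terms `[[a, b], [c, e]]` cancel in pairs (`s`), and `lam` of the Jacobi identity rewrites the
coefficients (`d`). -/
theorem omega_wedge_bracket (L : OmegaLieAlgebra V) {lam : V →ₗ[ℂ] ℂ}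
    (hlam : ∀ x y, L.omega x y = lam (L.bracket x y)) (x y z w : V) :
    L.omega x y • L.bracket z w - L.omega x z • L.bracket y w + L.omega x w • L.bracket y z
      + L.omega y z • L.bracket x w - L.omega y w • L.bracket x z + L.omega z w • L.bracket x y
      = (L.omega x y * lam z + L.omega y z * lam x - L.omega x z * lam y) • w
        - (L.omega x y * lam w + L.omega y w * lam x - L.omega x w * lam y) • z
        + (L.omega x z * lam w + L.omega z w * lam x - L.omega x w * lam z) • y
        - (L.omega y z * lam w + L.omega z w * lam y - L.omega y w * lam z) • x := by
  have d : ∀ a b c, L.omega (L.bracket a b) c - L.omega (L.bracket a c) b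
      + L.omega (L.bracket b c) a
      = L.omega a b * lam c + L.omega b c * lam a - L.omega a c * lam b := by
    intro a b c
    have h := congrArg lam (L.jacobi_ordered a b c)
    simp only [map_sub, map_add, map_smul, smul_eq_mul, ← hlam] at h
    exact h
  have j : ∀ a b c e, L.bracket (L.bracket (L.bracket a b) c) e
      - L.bracket (L.bracket (L.bracket a c) b) e + L.bracket (L.bracket (L.bracket b c) a) e
      = L.omega a b • L.bracket c e + L.omega b c • L.bracket a e
        - L.omega a c • L.bracket b e := by
    intro a b c e
    have h := congrArg (fun v => L.bracket v e) (L.jacobi_ordered a b c)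
    simpa only [map_sub, map_add, map_smul, LinearMap.add_apply, LinearMap.sub_apply,
      LinearMap.smul_apply] using h
  have i := fun a b c e => L.jacobi_ordered (L.bracket a b) c e
  have s : ∀ a b c e, L.bracket (L.bracket a b) (L.bracket c e)
      + L.bracket (L.bracket c e) (L.bracket a b) = 0 := by
    intro a b c e
    rw [L.bracket_skew]; simp
  have j1 := j x y z w
  have j2 := j x y w z
  have j3 := j x z w y
  have j4 := j y z w x
  rw [L.bracket_skew w z] at j2
  rw [L.bracket_skew z y, L.bracket_skew w y] at j3
  rw [L.bracket_skew y x, L.bracket_skew z x, L.bracket_skew w x] at j4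
  rw [← d x y z, ← d x y w, ← d x z w, ← d y z w]
  linear_combination (norm := module) i x y z w - i x z y w + i x w y z + i y z x w - i y w x z
    + i z w x y - j1 + j2 - j3 + j4 - s x y z w + s x z y w - s x w y z

/-- Applying `lam` to the previous identity kills its right side, which becomes alternating in two
factors `lam`. The conclusion says that `ω` has rank at most two. -/
theorem omega_pfaffian (L : OmegaLieAlgebra V) {lam : V →ₗ[ℂ] ℂ}
    (hlam : ∀ x y, L.omega x y = lam (L.bracket x y)) (x y z w : V) :
    L.omega x y * L.omega z w - L.omega x z * L.omega y w + L.omega x w * L.omega y z = 0 := by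
  have h := congrArg lam (L.omega_wedge_bracket hlam x y z w)
  simp only [map_sub, map_add, map_smul, smul_eq_mul, ← hlam] at h
  linear_combination h / 2

/-! ### The radical of `ω` and its action on the quotient -/

section Radical

variable {L : OmegaLieAlgebra V} {lam : V →ₗ[ℂ] ℂ}
  (hlam : ∀ x y, L.omega x y = lam (L.bracket x y)) {h k : V} (hk : L.omega h k = 1)
include hlam hk

theorem omega_eq_zero_of_coord {x : V} (h1 : L.omega x k = 0) (h2 : L.omega h x = 0) :
    L.omega x = 0 := by
  ext y
  have := L.omega_pfaffian hlam h k x y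
  rw [hk, h2, L.omega_skew k x, h1] at this
  simpa using this

theorem omega_radical_part (x : V) :
    L.omega (x - L.omega x k • h - L.omega h x • k) = 0 := by
  apply omega_eq_zero_of_coord hlam hk
  · simp [hk, L.omega_self]
  · simp [hk, L.omega_self]

theorem bracket_radical {r s : V} (hr : L.omega r = 0) (hs : L.omega s = 0) :
    L.bracket r s = lam r • s - lam s • r := by
  have hr' : ∀ y, L.omega y r = 0 := fun y => by rw [L.omega_skew, hr]; simp
  have hs' : ∀ y, L.omega y s = 0 := fun y => by rw [L.omega_skew, hs]; simp
  have := L.omega_wedge_bracket hlam h k r s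
  simpa [hr', hs', hk] using this

/-- The left side is the trace of `x ↦ [x, r]` on the quotient by the radical, in the basis `h, k`
with coordinates `ω(·, k)` and `ω(h, ·)`. -/
theorem trace_radical {r : V} (hr : L.omega r = 0) :
    L.omega (L.bracket h r) k + L.omega h (L.bracket k r) = -lam r := by
  have hr' : ∀ y, L.omega y r = 0 := fun y => by rw [L.omega_skew, hr]; simp
  have h := congrArg lam (L.jacobi_ordered h k r)
  simp only [map_sub, map_add, map_smul, smul_eq_mul, ← hlam, hr', hk] at h
  rw [L.omega_skew _ (L.bracket k r)]
  linear_combination -h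

theorem bracket_bracket_radical {r s : V} (hr : L.omega r = 0) (hs : L.omega s = 0) (x : V) :
    L.bracket (L.bracket x r) s - L.bracket (L.bracket x s) r
      = lam r • L.bracket x s - lam s • L.bracket x r := by
  have hr' : ∀ y, L.omega y r = 0 := fun y => by rw [L.omega_skew, hr]; simp
  have hs' : ∀ y, L.omega y s = 0 := fun y => by rw [L.omega_skew, hs]; simp
  have := L.jacobi_ordered x r s
  rw [bracket_radical hlam hk hr hs, hr', hs', hs', map_sub, map_smul, map_smul,
    LinearMap.sub_apply, LinearMap.smul_apply, LinearMap.smul_apply, L.bracket_skew s x,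
    L.bracket_skew r x] at this
  linear_combination (norm := module) this

theorem bracket_expand {s : V} (hs : L.omega s = 0) (p : V) :
    L.bracket p s = L.omega p k • L.bracket h s + L.omega h p • L.bracket k s
      + (lam (p - L.omega p k • h - L.omega h p • k) • s
        - lam s • (p - L.omega p k • h - L.omega h p • k)) := by
  rw [← bracket_radical hlam hk (omega_radical_part hlam hk p) hs]
  simp

theorem omega_bracket_expand {s : V} (hs : L.omega s = 0) (p q : V) :
    L.omega (L.bracket p s) q
      = L.omega p k * L.omega (L.bracket h s) q + L.omega h p * L.omega (L.bracket k s) q := by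
  have h1 := congrArg (fun v => L.omega v q) (bracket_expand hlam hk hs p)
  have h2 : L.omega (lam (p - L.omega p k • h - L.omega h p • k) • s
      - lam s • (p - L.omega p k • h - L.omega h p • k)) = 0 := by
    rw [map_sub L.omega, map_smul, map_smul, omega_radical_part hlam hk p, hs]
    simp
  simpa only [map_add, LinearMap.add_apply, h2, map_smul, LinearMap.smul_apply, smul_eq_mul,
    LinearMap.zero_apply, add_zero] using h1

/-- The matrices by which the radical of `ω` acts on the quotient satisfy the commutation
relations of the radical. -/
theorem radical_commutation {r s : V} (hr : L.omega r = 0) (hs : L.omega s = 0) (x q : V) :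
    L.omega (L.bracket x r) k * L.omega (L.bracket h s) q
      + L.omega h (L.bracket x r) * L.omega (L.bracket k s) q
      - (L.omega (L.bracket x s) k * L.omega (L.bracket h r) q
        + L.omega h (L.bracket x s) * L.omega (L.bracket k r) q)
      = lam r * L.omega (L.bracket x s) q - lam s * L.omega (L.bracket x r) q := by
  have h1 := congrArg (fun v => L.omega v q) (bracket_bracket_radical hlam hk hr hs x)
  simp only [map_sub, LinearMap.sub_apply, map_smul, LinearMap.smul_apply, smul_eq_mul] at h1
  rw [omega_bracket_expand hlam hk hs (L.bracket x r),
    omega_bracket_expand hlam hk hr (L.bracket x s)] at h1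
  exact h1

omit hlam hk

theorem finrank_le_three_of_separating [FiniteDimensional ℂ V] (f g l : V →ₗ[ℂ] ℂ)
    (H : ∀ x, f x = 0 → g x = 0 → l x = 0 → x = 0) : Module.finrank ℂ V ≤ 3 := by
  have hinj : Function.Injective (f.prod (g.prod l)) := by
    rw [← LinearMap.ker_eq_bot, LinearMap.ker_eq_bot']
    intro x hx
    simp only [LinearMap.prod_apply, Function.prod_apply, Prod.mk_eq_zero] at hx
    exact H x hx.1 hx.2.1 hx.2.2
  have := LinearMap.finrank_le_finrank_of_injective hinj
  simpa using this

end Radical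

/-! ### The dimension bound for `ω ≠ 0` -/

/-- If the part of the radical of `ω` killed by `lam` acts on the quotient by strictly triangular
matrices, not all zero, then a simple `ω`-Lie algebra has dimension at most three. -/
theorem IsSimple.finrank_le_three_of_triangular [FiniteDimensional ℂ V] {L : OmegaLieAlgebra V}
    (hL : L.IsSimple) {lam : V →ₗ[ℂ] ℂ} (hlam : ∀ x y, L.omega x y = lam (L.bracket x y))
    {h k z₀ : V} (hk : L.omega h k = 1) (hlk : lam k = 0)
    (hz₀ : L.omega z₀ = 0) (hlz₀ : lam z₀ = 0) (hβ : L.omega h (L.bracket h z₀) = 1)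
    (hα : ∀ z, L.omega z = 0 → lam z = 0 → L.omega (L.bracket h z) k = 0)
    (hγ : ∀ z, L.omega z = 0 → lam z = 0 → L.omega (L.bracket k z) k = 0) :
    Module.finrank ℂ V ≤ 3 := by
  have hδ : ∀ z, L.omega z = 0 → lam z = 0 → L.omega h (L.bracket k z) = 0 := by
    intro z hz hlz
    have := trace_radical hlam hk hz
    rw [hα z hz hlz, hlz] at this
    simpa using this
  have right0 : ∀ z, L.omega z = 0 → ∀ x, L.omega x z = 0 := by
    intro z hz x
    rw [L.omega_skew, hz]; simp
  have lam_bracket : ∀ z, L.omega z = 0 → ∀ x, lam (L.bracket x z) = 0 := by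
    intro z hz x
    rw [← hlam, right0 z hz]
  have kR : ∀ z, L.omega z = 0 → lam z = 0 → L.omega (L.bracket k z) = 0 := fun z hz hlz =>
    omega_eq_zero_of_coord hlam hk (hγ z hz hlz) (hδ z hz hlz)
  have hR : ∀ z, L.omega z = 0 → lam z = 0 → ∀ b, L.omega h (L.bracket h z) = b →
      L.omega (L.bracket h z - b • k) = 0 ∧ lam (L.bracket h z - b • k) = 0 := by
    intro z hz hlz b hb
    refine ⟨omega_eq_zero_of_coord hlam hk ?_ ?_, ?_⟩
    · simp [hα z hz hlz, L.omega_self]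
    · simp [hb, hk]
    · simp [lam_bracket z hz, hlk]
  obtain ⟨hA₀, hlA₀⟩ := hR z₀ hz₀ hlz₀ 1 hβ
  rw [one_smul] at hA₀ hlA₀
  set u := L.bracket k z₀ with hu
  -- Write `b(z) = ω(h, [h, z])` and `Z` for the part of the radical killed by `lam`. `Z` is abelian
  -- and `[h, z] ∈ b(z) k + Z`, so `[[h, z], z₀] = [[h, z₀], z]` reduces to `b(z) [k, z₀] = [k, z]`.
  have hku : ∀ z, L.omega z = 0 → lam z = 0 → L.bracket k z = L.omega h (L.bracket h z) • u := by
    intro z hz hlz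
    have e := bracket_bracket_radical hlam hk hz hz₀ h
    obtain ⟨hA, hlA⟩ := hR z hz hlz _ rfl
    have e1 := bracket_radical hlam hk hA hz₀
    have e2 := bracket_radical hlam hk hA₀ hz
    rw [hlA, hlz₀] at e1
    rw [hlA₀, hlz] at e2
    simp only [map_sub, map_smul, LinearMap.sub_apply, LinearMap.smul_apply] at e1 e2
    rw [hlz, hlz₀] at e
    linear_combination (norm := module) e1 - e - e2
  have hlu : lam u = 0 := lam_bracket z₀ hz₀ k
  have hRu : L.omega u = 0 := kR z₀ hz₀ hlz₀
  -- the expansion of `[h, k]`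
  set p := L.omega (L.bracket h k) k with hp
  set q := L.omega h (L.bracket h k) with hq
  set r := L.bracket h k - p • h - q • k with hr
  have hRr : L.omega r = 0 := omega_radical_part hlam hk _
  have hhk : L.bracket h k = p • h + q • k + r := by rw [hr]; abel
  have hkk : L.bracket k k = 0 := L.bracket_self k
  have jac : ∀ z, L.omega z = 0 → lam z = 0 →
      p • L.bracket h z + q • L.bracket k z + lam r • z - L.bracket (L.bracket h z) k
        + L.bracket (L.bracket k z) h = z := by
    intro z hz hlz
    have e := L.jacobi_ordered h k z
    have e1 := bracket_radical hlam hk hRr hz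
    rw [hk, right0 z hz, right0 z hz, hhk] at e
    simp only [map_add, map_smul, LinearMap.add_apply, LinearMap.smul_apply] at e
    rw [hlz] at e1
    linear_combination (norm := module) e - e1
  have hpu : p = L.omega h (L.bracket h u) := by
    have e := congrArg (L.omega h) (jac z₀ hz₀ hlz₀)
    have e1 : L.omega h (L.bracket (L.bracket h z₀) k) = 0 := by
      have : L.bracket (L.bracket h z₀) k = -L.bracket k (L.bracket h z₀ - k) := by
        rw [map_sub, hkk, sub_zero, L.bracket_skew]
      rw [this, map_neg, right0 _ (kR _ hA₀ hlA₀), neg_zero]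
    have e2 : L.omega h (L.bracket u h) = -L.omega h (L.bracket h u) := by
      rw [L.bracket_skew, map_neg]
    simp only [map_add, map_sub, map_smul, smul_eq_mul, e1, hβ, ← hu, right0 u hRu,
      right0 z₀ hz₀, e2] at e
    linear_combination e
  have dagger : ∀ z, L.omega z = 0 → lam z = 0 → L.omega h (L.bracket h z) = 0 →
      p • L.bracket h z + lam r • z + L.omega h (L.bracket h (L.bracket h z)) • u = z := by
    intro z hz hlz hbz
    have e := jac z hz hlz
    obtain ⟨hA, hlA⟩ := hR z hz hlz 0 hbz
    rw [zero_smul, sub_zero] at hA hlA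
    rw [L.bracket_skew (L.bracket h z) k, hku z hz hlz, hku _ hA hlA, hbz] at e
    simp only [zero_smul, smul_zero, map_zero, LinearMap.zero_apply] at e
    linear_combination (norm := module) e
  -- Apply `b` to `dagger`: since `b(u) = p` and `b(z) = 0`, the term `p b([h, z])` appears twice
  -- and nothing else survives.
  have hpβ : ∀ z, L.omega z = 0 → lam z = 0 → L.omega h (L.bracket h z) = 0 →
      p * L.omega h (L.bracket h (L.bracket h z)) = 0 := by
    intro z hz hlz hbz
    have e := congrArg (fun v => L.omega h (L.bracket h v)) (dagger z hz hlz hbz)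
    simp only [map_add, map_smul, smul_eq_mul, hbz, ← hpu] at e
    linear_combination e / 2
  -- The commutator of the matrices of `e` and `z₀` is that of `z₀`; with the trace this gives `[h,
  -- e] ∈ ℂ k + Z` and `[k, e] ∈ -k + Z`. The Jacobi identity for `h, k, e` modulo `k^⊥` then gives
  -- `p = 0`.
  have he : ∀ e, L.omega e = 0 → lam e = 1 →
      L.omega (L.bracket h e) k = 0 ∧ L.omega (L.bracket k e) k = 0 ∧ p = 0 := by
    intro e hRe hle
    have c1 := radical_commutation hlam hk hRe hz₀ h k
    have c2 := radical_commutation hlam hk hRe hz₀ h h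
    have c3 := trace_radical hlam hk hRe
    have t : ∀ x y, L.omega x y = -L.omega y x := L.omega_skew
    rw [hα z₀ hz₀ hlz₀, hγ z₀ hz₀ hlz₀, hβ, hle, hlz₀] at c1
    rw [t _ h, t (L.bracket k z₀) h, t (L.bracket h e) h, t (L.bracket k e) h,
      hα z₀ hz₀ hlz₀, hδ z₀ hz₀ hlz₀, hβ, hle, hlz₀] at c2
    rw [hle] at c3
    have hc : L.omega (L.bracket k e) k = 0 := by linear_combination -c1
    have ha : L.omega (L.bracket h e) k = 0 := by linear_combination (c3 - c2) / 2
    have hd : L.omega h (L.bracket k e) = -1 := by linear_combination c3 - ha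
    refine ⟨ha, hc, ?_⟩
    have hr1 : L.omega (L.bracket h e - L.omega h (L.bracket h e) • k) = 0 := by
      apply omega_eq_zero_of_coord hlam hk
      · simp [ha, L.omega_self]
      · simp [hk]
    have hr2 : L.omega (L.bracket k e + k) = 0 := by
      apply omega_eq_zero_of_coord hlam hk
      · simp [hc, L.omega_self]
      · simp [hk, hd]
    have hl1 : lam (L.bracket h e - L.omega h (L.bracket h e) • k) = 0 := by
      simp [lam_bracket e hRe, hlk]
    have hl2 : lam (L.bracket k e + k) = 0 := by simp [lam_bracket e hRe, hlk]
    have g1 := hγ _ hr1 hl1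
    have g2 := hα _ hr2 hl2
    simp only [map_sub, map_add, map_smul, hkk, smul_zero, sub_zero, LinearMap.add_apply] at g1 g2
    have j := congrArg (fun v => L.omega v k) (L.jacobi_ordered h k e)
    rw [right0 e hRe, right0 e hRe, hk] at j
    simp only [map_sub, map_add, LinearMap.add_apply, LinearMap.sub_apply, zero_smul, add_zero,
      sub_zero, one_smul, hRe, LinearMap.zero_apply] at j
    rw [omega_bracket_expand hlam hk hRe, ha, hc, L.bracket_skew (L.bracket h e),
      L.bracket_skew (L.bracket k e)] at j
    simp only [map_neg, LinearMap.neg_apply, g1] at j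
    rw [← hp] at g2
    linear_combination j + g2
  have hk0 : k ≠ 0 := by
    rintro rfl
    simp at hk
  by_cases hp0 : p = 0
  · exfalso
    have hlr : lam r = 1 := by
      have e := congrArg lam hhk
      rw [← hlam, hk, hp0] at e
      simpa [hlk] using e.symm
    obtain ⟨ha, hc, -⟩ := he r hRr hlr
    have split : ∀ s, L.omega s = 0 →
        L.omega (L.bracket h s) k = 0 ∧ L.omega (L.bracket k s) k = 0 := by
      intro s hs
      have h1 : L.omega (s - lam s • r) = 0 := by simp [hs, hRr]
      have h2 : lam (s - lam s • r) = 0 := by simp [hlr]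
      have a1 := hα _ h1 h2
      have a2 := hγ _ h1 h2
      simp only [map_sub, map_smul, LinearMap.sub_apply, LinearMap.smul_apply, ha, hc,
        smul_zero, sub_zero] at a1 a2
      exact ⟨a1, a2⟩
    -- When `p = 0`, `lam r = 1` and the whole radical becomes triangular, so `k^⊥` is an ideal; it
    -- contains `k` but not `h`.
    have hideal : L.IsIdeal (LinearMap.ker (L.omega.flip k)) := by
      intro x hx y
      rw [LinearMap.mem_ker, LinearMap.flip_apply] at hx ⊢
      have hxs := omega_radical_part hlam hk x
      rw [hx, zero_smul, sub_zero] at hxs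
      set s := x - L.omega h x • k with hs
      have hxe : x = s + L.omega h x • k := by rw [hs]; abel
      have hys : L.omega (L.bracket y s) k = 0 := by
        rw [omega_bracket_expand hlam hk hxs, (split s hxs).1, (split s hxs).2]; ring
      have hyk : L.omega (L.bracket y k) k = 0 := by
        have ht := omega_radical_part hlam hk y
        set t := y - L.omega y k • h - L.omega h y • k with ht'
        have hye : y = t + L.omega y k • h + L.omega h y • k := by rw [ht']; abel
        have e : L.omega (L.bracket t k) k = 0 := by
          rw [L.bracket_skew]; simp [(split t ht).2]
        rw [hye]
        simp only [map_add, map_smul, LinearMap.add_apply, LinearMap.smul_apply, e, hkk,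
          ← hp, hp0]
        simp
      rw [L.bracket_skew, hxe]
      simp [hys, hyk]
    rcases hL.2 _ hideal with hb | ht
    · have : k ∈ LinearMap.ker (L.omega.flip k) := by simp [L.omega_self]
      rw [hb] at this
      exact hk0 (by simpa using this)
    · have : h ∈ LinearMap.ker (L.omega.flip k) := ht ▸ Submodule.mem_top
      rw [LinearMap.mem_ker, LinearMap.flip_apply, hk] at this
      exact one_ne_zero this
  · have hlamR : ∀ s, L.omega s = 0 → lam s = 0 := by
      intro s hs
      by_contra hne
      exact hp0 (he ((lam s)⁻¹ • s) (by simp [hs]) (by simp [hne])).2.2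
    -- When `p ≠ 0`, `lam` vanishes on the radical and the kernel of `b` there is an ideal: `k`
    -- annihilates it by `hku`, `h` preserves it by `hpβ`. So it is zero, and `b` is the third
    -- coordinate.
    have hideal : L.IsIdeal (LinearMap.ker L.omega ⊓
        LinearMap.ker ((L.omega h) ∘ₗ (L.bracket h))) := by
      rintro z ⟨hz, hbz⟩ y
      simp only [SetLike.mem_coe, LinearMap.mem_ker, LinearMap.comp_apply] at hz hbz
      have hlz := hlamR z hz
      have e := bracket_expand hlam hk hz y
      rw [hku z hz hlz, hbz, hlz] at e
      obtain ⟨hA, hlA⟩ := hR z hz hlz 0 hbz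
      rw [zero_smul, sub_zero] at hA hlA
      have hbA := (mul_eq_zero.mp (hpβ z hz hlz hbz)).resolve_left hp0
      rw [L.bracket_skew, e]
      simp only [zero_smul, smul_zero, add_zero, sub_zero]
      have m1 : L.bracket h z ∈ LinearMap.ker L.omega ⊓
          LinearMap.ker ((L.omega h) ∘ₗ (L.bracket h)) := ⟨hA, hbA⟩
      have m2 : z ∈ LinearMap.ker L.omega ⊓
          LinearMap.ker ((L.omega h) ∘ₗ (L.bracket h)) := ⟨hz, hbz⟩
      exact neg_mem (add_mem (Submodule.smul_mem _ _ m1) (Submodule.smul_mem _ _ m2))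
    have hbot := (hL.2 _ hideal).resolve_right fun ht => by
      have : h ∈ LinearMap.ker L.omega ⊓ LinearMap.ker ((L.omega h) ∘ₗ (L.bracket h)) :=
        ht ▸ Submodule.mem_top
      have h1 : L.omega h = 0 := this.1
      rw [h1] at hk
      simp at hk
    refine finrank_le_three_of_separating (L.omega.flip k) (L.omega h)
      ((L.omega h) ∘ₗ (L.bracket h)) fun x h1 h2 h3 => ?_
    have hx : x ∈ LinearMap.ker L.omega ⊓ LinearMap.ker ((L.omega h) ∘ₗ (L.bracket h)) :=
      ⟨omega_eq_zero_of_coord hlam hk h1 h2, h3⟩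
    rw [hbot] at hx
    simpa using hx

/-- A simple `ω`-Lie algebra with `ω ≠ 0` has dimension at most three. -/
theorem IsSimple.finrank_le_three [FiniteDimensional ℂ V] {L : OmegaLieAlgebra V}
    (hL : L.IsSimple) (h0 : L.omega ≠ 0) : Module.finrank ℂ V ≤ 3 := by
  by_contra hn
  obtain ⟨lam, hlam⟩ := L.exists_omega_eq_apply_bracket (by omega)
  have right0 : ∀ z, L.omega z = 0 → ∀ x, L.omega x z = 0 := by
    intro z hz x
    rw [L.omega_skew, hz]; simp
  have normalize : ∀ k, L.omega k ≠ 0 → ∃ h, L.omega h k = 1 := by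
    intro k hk
    obtain ⟨v, hv⟩ : ∃ v, L.omega k v ≠ 0 := by
      by_contra! hc
      exact hk (LinearMap.ext hc)
    refine ⟨-(L.omega k v)⁻¹ • v, ?_⟩
    rw [L.omega_skew]
    simp [hv]
  -- Otherwise `ker ω ∩ ker lam` is an ideal, hence zero, and `ω(·, k)`, `ω(h, ·)`, `lam` separate
  -- points.
  obtain ⟨z₀, y, hz₀, hlz₀, hy⟩ : ∃ z₀ y, L.omega z₀ = 0 ∧ lam z₀ = 0 ∧
      L.omega (L.bracket y z₀) ≠ 0 := by
    by_contra! hc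
    have hideal : L.IsIdeal (LinearMap.ker L.omega ⊓ LinearMap.ker lam) := by
      rintro z ⟨hz, hlz⟩ y
      refine ⟨?_, ?_⟩
      · rw [SetLike.mem_coe, LinearMap.mem_ker, L.bracket_skew, map_neg, hc z y hz hlz, neg_zero]
      · rw [SetLike.mem_coe, LinearMap.mem_ker, ← hlam, show L.omega z = 0 from hz]
        simp
    rcases hL.2 _ hideal with hb | ht
    · obtain ⟨k, hk⟩ : ∃ k, L.omega k ≠ 0 := by
        by_contra! hc'
        exact h0 (LinearMap.ext hc')
      obtain ⟨h, hhk⟩ := normalize k hk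
      refine hn (finrank_le_three_of_separating (L.omega.flip k) (L.omega h) lam
        fun x h1 h2 h3 => ?_)
      have hx : x ∈ LinearMap.ker L.omega ⊓ LinearMap.ker lam :=
        ⟨omega_eq_zero_of_coord hlam hhk h1 h2, h3⟩
      rw [hb] at hx
      simpa using hx
    · apply h0
      refine LinearMap.ext fun x => ?_
      have hx : x ∈ LinearMap.ker L.omega ⊓ LinearMap.ker lam := ht ▸ Submodule.mem_top
      exact hx.1
  obtain ⟨h, hk⟩ := normalize _ hy
  set k := L.bracket y z₀ with hkdef
  have hlk : lam k = 0 := by rw [hkdef, ← hlam, right0 z₀ hz₀]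
  have trc := fun z hz => trace_radical hlam hk (r := z) hz
  have hk1 := omega_bracket_expand hlam hk hz₀ y k
  have hk2 := omega_bracket_expand hlam hk hz₀ y h
  rw [← hkdef, L.omega_self] at hk1
  rw [← hkdef, L.omega_skew k h, L.omega_skew _ h, L.omega_skew (L.bracket k z₀) h, hk] at hk2
  have tr₀ := trc z₀ hz₀
  rw [hlz₀] at tr₀
  -- If `lam` vanishes on the radical, it is a nonzero multiple of `ω(·, k)` and kills `[x, z₀]`.
  -- Otherwise some `e` has `lam e = 1`, and the matrix of `z₀`, being its own commutator with that
  -- of `e`, is nilpotent; as `k` lies in its image, it is strictly triangular.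
  have hz₀tri : L.omega (L.bracket h z₀) k = 0 ∧ L.omega (L.bracket k z₀) k = 0 := by
    by_cases hR : ∀ s, L.omega s = 0 → lam s = 0
    · have hdec : ∀ x, lam x = L.omega x k * lam h := by
        intro x
        have := hR _ (omega_radical_part hlam hk x)
        simp only [map_sub, map_smul, smul_eq_mul, hlk] at this
        linear_combination this
      have hlh : lam h ≠ 0 := by
        intro hz
        have := hdec (L.bracket h k)
        rw [← hlam, hk, hz] at this
        simp at this
      have e : ∀ x, L.omega (L.bracket x z₀) k = 0 := by
        intro x
        have := hdec (L.bracket x z₀)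
        rw [← hlam, right0 z₀ hz₀] at this
        exact (mul_eq_zero.mp this.symm).resolve_right hlh
      exact ⟨e h, e k⟩
    · push Not at hR
      obtain ⟨s, hs, hls⟩ := hR
      have hRe : L.omega ((lam s)⁻¹ • s) = 0 := by simp [hs]
      have hle : lam ((lam s)⁻¹ • s) = 1 := by simp [hls]
      set e := (lam s)⁻¹ • s
      have c1 := radical_commutation hlam hk hRe hz₀ h k
      have c2 := radical_commutation hlam hk hRe hz₀ h h
      have c3 := radical_commutation hlam hk hRe hz₀ k k
      have tre := trc e hRe
      rw [hle, hlz₀] at c1 c2 c3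
      rw [hle] at tre
      have t : ∀ x, L.omega x h = -L.omega h x := fun x => L.omega_skew x h
      simp only [t] at c2
      generalize L.omega (L.bracket h z₀) k = α at *
      generalize L.omega (L.bracket k z₀) k = γ at *
      generalize L.omega h (L.bracket h z₀) = β at *
      generalize L.omega h (L.bracket k z₀) = δ at *
      generalize L.omega (L.bracket h e) k = a at *
      generalize L.omega (L.bracket k e) k = c at *
      generalize L.omega h (L.bracket h e) = b at *
      generalize L.omega h (L.bracket k e) = d at *
      obtain rfl : δ = -α := by linear_combination tr₀
      obtain rfl : d = -1 - a := by linear_combination tre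
      have hdet : α ^ 2 + β * γ = 0 := by
        linear_combination (-α) * c1 + γ / 2 * c2 - β / 2 * c3
      exact ⟨by linear_combination (-α) * hk2 - β * hk1 - L.omega h y * hdet,
        by linear_combination (-γ) * hk2 + α * hk1 + L.omega y k * hdet⟩
  have hβ : L.omega h (L.bracket h z₀) ≠ 0 := by
    intro hb
    rw [hz₀tri.1] at tr₀
    rw [hb] at hk2
    have : (1 : ℂ) = 0 := by linear_combination -hk2 + L.omega h y * tr₀
    exact one_ne_zero this
  -- A traceless 2 × 2 matrix commuting with a nonzero strictly triangular one is a multiple of it.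
  have tri : ∀ z, L.omega z = 0 → lam z = 0 →
      L.omega (L.bracket h z) k = 0 ∧ L.omega (L.bracket k z) k = 0 := by
    intro z hz hlz
    have c1 := radical_commutation hlam hk hz hz₀ h k
    have c2 := radical_commutation hlam hk hz hz₀ h h
    have trz := trc z hz
    have t : ∀ x, L.omega x h = -L.omega h x := fun x => L.omega_skew x h
    simp only [t] at c2
    rw [hz₀tri.1] at c1 c2 tr₀
    rw [hz₀tri.2] at c1
    rw [hlz, hlz₀] at c1 c2
    rw [hlz] at trz
    constructor
    · apply mul_left_cancel₀ hβ
      linear_combination -c2 / 2 - L.omega h (L.bracket h z) / 2 * tr₀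
        + L.omega h (L.bracket h z₀) / 2 * trz
    · apply mul_left_cancel₀ hβ
      linear_combination -c1
  refine hn (hL.finrank_le_three_of_triangular hlam hk hlk
    (z₀ := (L.omega h (L.bracket h z₀))⁻¹ • z₀) ?_ ?_ ?_ (fun z hz hl => (tri z hz hl).1)
    (fun z hz hl => (tri z hz hl).2))
  · simp [hz₀]
  · simp [hlz₀]
  · simp [hβ]

/-! ### Three-dimensional simple algebras with a nilpotent ½-derivation -/

/-- Three independent vectors in a three-dimensional space, as a spanning statement. -/
theorem exists_coord_of_linearIndependent {a b c : V} (hV : Module.finrank ℂ V = 3)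
    (h : LinearIndependent ℂ ![a, b, c]) (x : V) : ∃ r s t : ℂ, x = r • a + s • b + t • c := by
  have htop := h.span_eq_top_of_card_eq_finrank (by simp [hV])
  have hx : x ∈ Submodule.span ℂ (Set.range ![a, b, c]) := htop ▸ Submodule.mem_top
  rw [Submodule.mem_span_range_iff_exists_fun] at hx
  obtain ⟨f, hf⟩ := hx
  refine ⟨f 0, f 1, f 2, ?_⟩
  rw [← hf, Fin.sum_univ_three]
  rfl

/-- In dimension two a nonzero `[a, b]` spans an ideal. -/
theorem IsSimple.three_le_finrank [FiniteDimensional ℂ V] {L : OmegaLieAlgebra V}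
    (hL : L.IsSimple) : 3 ≤ Module.finrank ℂ V := by
  by_contra hn
  obtain ⟨a, b, hab⟩ := hL.1
  have hli : LinearIndependent ℂ ![a, b] := by
    rw [LinearIndependent.pair_iff]
    intro s t hst
    have h1 := congrArg (fun v => L.bracket v b) hst
    have h2 := congrArg (L.bracket a) hst
    simp only [map_add, map_smul, LinearMap.add_apply, LinearMap.smul_apply, L.bracket_self,
      smul_zero, add_zero, zero_add, map_zero, LinearMap.zero_apply, smul_eq_zero, hab,
      or_false] at h1 h2
    exact ⟨h1, h2⟩
  have hcard := hli.fintype_card_le_finrank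
  simp only [Fintype.card_fin] at hcard
  have htop := hli.span_eq_top_of_card_eq_finrank (by simp; omega)
  have hco : ∀ x : V, ∃ r s : ℂ, x = r • a + s • b := by
    intro x
    have hx : x ∈ Submodule.span ℂ (Set.range ![a, b]) := htop ▸ Submodule.mem_top
    rw [Submodule.mem_span_range_iff_exists_fun] at hx
    obtain ⟨f, hf⟩ := hx
    refine ⟨f 0, f 1, ?_⟩
    rw [← hf, Fin.sum_univ_two]
    rfl
  have hideal : L.IsIdeal (Submodule.span ℂ {L.bracket a b}) := by
    intro x _ y
    obtain ⟨r, s, rfl⟩ := hco x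
    obtain ⟨r', s', rfl⟩ := hco y
    rw [Submodule.mem_span_singleton]
    refine ⟨r * s' - s * r', ?_⟩
    simp only [map_add, map_smul, LinearMap.add_apply, LinearMap.smul_apply, L.bracket_self,
      L.bracket_skew b a]
    module
  rcases hL.2 _ hideal with h | h
  · exact hab (by simpa using h)
  · have := finrank_span_singleton (K := ℂ) hab
    rw [h, finrank_top] at this
    omega

/-- In a simple algebra of dimension three no line is an ideal. -/
theorem IsSimple.eq_zero_of_line {L : OmegaLieAlgebra V} (hL : L.IsSimple)
    (hV : Module.finrank ℂ V = 3) {v : V} (hv : ∀ y, ∃ c : ℂ, L.bracket v y = c • v) :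
    v = 0 := by
  by_contra hv0
  have hideal : L.IsIdeal (Submodule.span ℂ {v}) := by
    intro x hx y
    obtain ⟨r, rfl⟩ := Submodule.mem_span_singleton.mp hx
    obtain ⟨c, hc⟩ := hv y
    rw [map_smul, LinearMap.smul_apply, hc]
    exact Submodule.smul_mem _ _ (Submodule.smul_mem _ _ (Submodule.mem_span_singleton_self v))
  rcases hL.2 _ hideal with h | h
  · exact hv0 (by simpa using h)
  · have := finrank_span_singleton (K := ℂ) hv0
    rw [h, finrank_top] at this
    omega

/-- `a, b, c` are eigenvectors of `ad a` for the distinct eigenvalues `0, 1, α`, hence a basis.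
Comparing coefficients in the Jacobi identity then recovers `ω`, so matching brackets suffices. -/
theorem isomorphic_algC_of_bracket [FiniteDimensional ℂ V] {L : OmegaLieAlgebra V}
    (hV : Module.finrank ℂ V = 3) {α : ℂ} (hα : α ≠ 0) (hα1 : α ≠ 1) {a b c : V} (ha : a ≠ 0)
    (hab : L.bracket a b = b) (hac : L.bracket a c = α • c) (hbc : L.bracket b c = a) :
    L.Isomorphic (algC α) := by
  have hb : b ≠ 0 := by rintro rfl; simp at hbc; exact ha hbc.symm
  have hc : c ≠ 0 := by rintro rfl; simp at hbc; exact ha hbc.symm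
  have hzero : ∀ r s t : ℂ, r • a + s • b + t • c = 0 → r = 0 ∧ s = 0 ∧ t = 0 := by
    intro r s t h
    have h1 := congrArg (L.bracket a) h
    have h2 := congrArg (fun v => L.bracket a (L.bracket a v)) h
    simp only [map_add, map_smul, L.bracket_self, hab, hac, map_zero] at h1 h2
    have ht : (α * (α - 1) * t) • c = 0 := by
      linear_combination (norm := module) h2 - h1
    have ht0 : t = 0 := by
      simpa [hc, hα, sub_ne_zero.mpr hα1] using ht
    subst ht0
    have hs : s = 0 := by simpa [hb] using h1
    subst hs
    exact ⟨by simpa [ha] using h, rfl, rfl⟩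
  have hli : LinearIndependent ℂ ![a, b, c] := by
    rw [Fintype.linearIndependent_iff]
    intro g hg
    rw [Fin.sum_univ_three] at hg
    obtain ⟨h0, h1, h2⟩ := hzero _ _ _ hg
    intro i
    fin_cases i
    · exact h0
    · exact h1
    · exact h2
  have hba : L.bracket b a = -b := by rw [L.bracket_skew, hab]
  have hca : L.bracket c a = -(α • c) := by rw [L.bracket_skew, hac]
  have hcb : L.bracket c b = -a := by rw [L.bracket_skew, hbc]
  have hω : L.omega a b = 0 ∧ L.omega a c = 0 ∧ L.omega b c = 1 + α := by
    have hj := L.jacobi_ordered a b c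
    rw [hab, hac, hbc] at hj
    simp only [map_smul, LinearMap.smul_apply, hcb, L.bracket_self] at hj
    obtain ⟨h1, h2, h3⟩ := hzero (L.omega b c - (1 + α)) (-L.omega a c) (L.omega a b)
      (by linear_combination (norm := module) -hj)
    exact ⟨h3, neg_eq_zero.mp h2, sub_eq_zero.mp h1⟩
  obtain ⟨oab, oac, obc⟩ := hω
  have oba : L.omega b a = 0 := by rw [L.omega_skew, oab, neg_zero]
  have oca : L.omega c a = 0 := by rw [L.omega_skew, oac, neg_zero]
  have ocb : L.omega c b = -(1 + α) := by rw [L.omega_skew, obc]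
  let B := basisOfLinearIndependentOfCardEqFinrank hli (by simp [hV])
  have hB0 : B 0 = a := by simp [B]
  have hB1 : B 1 = b := by simp [B]
  have hB2 : B 2 = c := by simp [B]
  have hinv : ∀ x : Fin 3 → ℂ, B.equivFun.symm x = x 0 • a + x 1 • b + x 2 • c := by
    intro x
    rw [Module.Basis.equivFun_symm_apply, Fin.sum_univ_three, hB0, hB1, hB2]
  have hrep : ∀ x : V, x = B.equivFun x 0 • a + B.equivFun x 1 • b + B.equivFun x 2 • c := by
    intro x
    rw [← hinv, LinearEquiv.symm_apply_apply]
  refine ⟨B.equivFun, fun x y => ?_, fun x y => ?_⟩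
  · rw [← LinearEquiv.eq_symm_apply, hinv]
    simp only [algC, LinearMap.mk₂_apply]
    conv_lhs => rw [hrep x, hrep y]
    simp only [map_add, map_smul, LinearMap.add_apply, LinearMap.smul_apply, L.bracket_self,
      hab, hac, hbc, hba, hca, hcb, Matrix.cons_val]
    module
  · simp only [algC, LinearMap.mk₂_apply]
    conv_lhs => rw [hrep x, hrep y]
    simp only [map_add, map_smul, LinearMap.add_apply, LinearMap.smul_apply, L.omega_self,
      oab, oac, obc, oba, oca, ocb, smul_eq_mul]
    ring

theorem isomorphic_algC_half [FiniteDimensional ℂ V] {L : OmegaLieAlgebra V}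
    (hV : Module.finrank ℂ V = 3) {e u w : V} {b c p q : ℂ} (hu : u ≠ 0) (hq : q ≠ 0)
    (heu : L.bracket e u = u) (hew : L.bracket e w = (1 / 2 : ℂ) • w + b • u + c • e)
    (huw : L.bracket u w = p • u + q • e) : L.Isomorphic (algC (1 / 2)) := by
  -- For any `r`, the third vector below is an eigenvector of `ad (e + r u)` for `1/2`; `[u, ·]` of
  -- it equals `e + r u` exactly when `3 q r = p - 2 c`.
  obtain ⟨r, hr⟩ : ∃ r : ℂ, r = (p - 2 * c) / (3 * q) := ⟨_, rfl⟩
  have hr' : 3 * q * r = p - 2 * c := by rw [hr]; field_simp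
  have hue : L.bracket u e = -u := by rw [L.bracket_skew, heu]
  refine isomorphic_algC_of_bracket hV (by norm_num) (by norm_num) (a := e + r • u) (b := u)
    (c := q⁻¹ • (w + (2 * (c + r * q)) • (e + r • u)
      + (-2 * (b + r * p - r * c - r ^ 2 * q)) • u)) ?_ ?_ ?_ ?_
  · intro h0
    have := congrArg (fun v => L.bracket v u) h0
    simp [heu, L.bracket_self, hu] at this
  · simp [heu, L.bracket_self]
  · simp only [map_add, map_smul, LinearMap.add_apply, LinearMap.smul_apply, L.bracket_self,
      heu, hew, huw, hue]
    match_scalars <;> field_simp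
    ring
  · simp only [map_add, map_smul, L.bracket_self, huw, hue]
    match_scalars
    · field_simp
      linear_combination -hr'
    · field_simp

theorem isomorphic_algC_neg_quarter [FiniteDimensional ℂ V] {L : OmegaLieAlgebra V}
    (hV : Module.finrank ℂ V = 3) {x y z : V} {a b c : ℂ} (hx : x ≠ 0) (ha : a ≠ 0)
    (hxy : L.bracket x y = a • x) (hxz : L.bracket x z = (a / 2) • y + b • x)
    (hyz : L.bracket y z = (a / 4) • z + (b / 2) • y + c • x) :
    L.Isomorphic (algC (-1 / 4)) := by
  -- `s` makes `[x, z + s y]` proportional to `y + s x`; `t` then makes `z + s y + t x` an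
  -- eigenvector of `ad (y + s x)`.
  obtain ⟨s, hs⟩ : ∃ s : ℂ, s = -2 * b / a := ⟨_, rfl⟩
  obtain ⟨t, ht⟩ : ∃ t : ℂ, t = 4 / (5 * a) * (c + 2 * b ^ 2 / a) := ⟨_, rfl⟩
  have hyx : L.bracket y x = -(a • x) := by rw [L.bracket_skew, hxy]
  refine isomorphic_algC_of_bracket hV (by norm_num) (by norm_num) (a := (-1 / a) • (y + s • x))
    (b := x) (c := (-2 / a ^ 2) • (z + s • y + t • x)) ?_ ?_ ?_ ?_
  · intro h0
    have := congrArg (L.bracket x) h0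
    simp [hxy, L.bracket_self, hx, ha] at this
  · simp only [map_add, map_smul, LinearMap.add_apply, LinearMap.smul_apply, L.bracket_self, hyx]
    match_scalars
    field_simp
  · simp only [map_add, map_smul, LinearMap.add_apply, LinearMap.smul_apply, L.bracket_self,
      hyx, hxy, hxz, hyz, hs, ht]
    match_scalars <;> field_simp <;> ring
  · simp only [map_add, map_smul, L.bracket_self, hxy, hxz, hs]
    match_scalars <;> field_simp
    ring

theorem IsHalfDerivation.two_smul_apply_bracket {L : OmegaLieAlgebra V} {D : V →ₗ[ℂ] V}
    (hD : L.IsHalfDerivation D) (x y : V) :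
    (2 : ℂ) • D (L.bracket x y) = L.bracket (D x) y + L.bracket x (D y) := by
  rw [hD x y]
  module

/-- In the Jordan basis `N² z, N z, z` the ½-derivation rule leaves three free constants `a, b, c`;
if `a = 0`, the line of `N² z` is an ideal. -/
theorem IsSimple.isomorphic_of_sq_ne_zero [FiniteDimensional ℂ V] {L : OmegaLieAlgebra V}
    (hL : L.IsSimple) (hV : Module.finrank ℂ V = 3) {N : Module.End ℂ V}
    (hN : L.IsHalfDerivation N) {z : V} (hz : N (N z) ≠ 0) (hz3 : N (N (N z)) = 0) :
    L.Isomorphic (algC (-1 / 4)) := by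
  obtain ⟨y, hy⟩ : ∃ y, y = N z := ⟨_, rfl⟩
  obtain ⟨x, hx⟩ : ∃ x, x = N y := ⟨_, rfl⟩
  rw [← hy, ← hx] at hz hz3
  have hzero : ∀ r s t : ℂ, r • x + s • y + t • z = 0 → r = 0 ∧ s = 0 ∧ t = 0 := by
    intro r s t h
    have h1 := congrArg N h
    have h2 := congrArg (fun v => N (N v)) h
    simp only [map_add, map_smul, hz3, ← hx, ← hy, map_zero, smul_zero, zero_add, smul_eq_zero,
      hz, or_false] at h1 h2
    subst h2
    have hs : s = 0 := by simpa [hz] using h1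
    subst hs
    exact ⟨by simpa [hz] using h, rfl, rfl⟩
  have hco := exists_coord_of_linearIndependent (a := x) (b := y) (c := z) hV (by
    rw [Fintype.linearIndependent_iff]
    intro g hg
    rw [Fin.sum_univ_three] at hg
    obtain ⟨h0, h1, h2⟩ := hzero _ _ _ hg
    intro i
    fin_cases i
    · exact h0
    · exact h1
    · exact h2)
  have exy := hN.two_smul_apply_bracket x y
  have exz := hN.two_smul_apply_bracket x z
  have eyz := hN.two_smul_apply_bracket y z
  rw [hz3, ← hx, L.bracket_self, map_zero, LinearMap.zero_apply, zero_add] at exy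
  rw [hz3, ← hy, map_zero, LinearMap.zero_apply, zero_add] at exz
  rw [← hx, ← hy, L.bracket_self, add_zero] at eyz
  obtain ⟨a, a', a'', hxy⟩ := hco (L.bracket x y)
  obtain ⟨b, b', b'', hxz⟩ := hco (L.bracket x z)
  obtain ⟨c, c', c'', hyz⟩ := hco (L.bracket y z)
  rw [hxy] at exy exz
  rw [hxz] at exz eyz
  rw [hyz] at eyz
  simp only [map_add, map_smul, hz3, ← hx, ← hy] at exy exz eyz
  obtain ⟨f1, f2, -⟩ := hzero (2 * a') (2 * a'') 0 (by linear_combination (norm := module) exy)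
  have f1' : a' = 0 := by simpa using f1
  have f2' : a'' = 0 := by simpa using f2
  subst f1' f2'
  obtain ⟨g1, g2, -⟩ := hzero (2 * b' - a) (2 * b'') 0 (by linear_combination (norm := module) exz)
  have g1' : b' = a / 2 := by linear_combination g1 / 2
  have g2' : b'' = 0 := by simpa using g2
  subst g1' g2'
  obtain ⟨k1, k2, -⟩ := hzero (2 * c' - b) (2 * c'' - a / 2) 0
    (by linear_combination (norm := module) eyz)
  have k1' : c' = b / 2 := by linear_combination k1 / 2
  have k2' : c'' = a / 4 := by linear_combination k2 / 2
  subst k1' k2'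
  refine isomorphic_algC_neg_quarter hV (x := x) (y := y) (z := z) (a := a) (b := b) (c := c)
    hz ?_ ?_ ?_ ?_
  · rintro rfl
    refine hz (hL.eq_zero_of_line hV fun v => ?_)
    obtain ⟨r, s, t, rfl⟩ := hco v
    refine ⟨t * b, ?_⟩
    simp only [map_add, map_smul, L.bracket_self, hxy, hxz]
    module
  · rw [hxy]; module
  · rw [hxz]; module
  · rw [hyz]; module

theorem IsSimple.isomorphic_of_sq_eq_zero [FiniteDimensional ℂ V] {L : OmegaLieAlgebra V}
    (hL : L.IsSimple) (hV : Module.finrank ℂ V = 3) {N : Module.End ℂ V}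
    (hN : L.IsHalfDerivation N) {w : V} (hw : N w ≠ 0) (hN2 : ∀ x, N (N x) = 0) :
    L.Isomorphic (algC (1 / 2)) := by
  obtain ⟨u, hu⟩ : ∃ u, u = N w := ⟨_, rfl⟩
  have hNu : N u = 0 := by rw [hu, hN2]
  rw [← hu] at hw
  -- `N² = 0` in dimension three forces `dim ker N ≥ 2`.
  obtain ⟨v, hNv, hv⟩ : ∃ v, N v = 0 ∧ v ∉ Submodule.span ℂ {u} := by
    by_contra! hc
    have h1 : LinearMap.ker N ≤ Submodule.span ℂ {u} := fun x hx => hc x hx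
    have h2 : LinearMap.range N ≤ LinearMap.ker N := by
      rintro _ ⟨x, rfl⟩
      exact hN2 x
    have h3 := Submodule.finrank_mono h1
    have h4 := Submodule.finrank_mono h2
    have h5 := LinearMap.finrank_range_add_finrank_ker N
    rw [finrank_span_singleton hw] at h3
    omega
  have hzero : ∀ r s t : ℂ, r • u + s • v + t • w = 0 → r = 0 ∧ s = 0 ∧ t = 0 := by
    intro r s t h
    have h1 := congrArg N h
    simp only [map_add, map_smul, hNu, hNv, ← hu, map_zero, smul_zero, zero_add, smul_eq_zero,
      hw, or_false] at h1
    subst h1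
    have hs : s = 0 := by
      by_contra hs
      refine hv (Submodule.mem_span_singleton.mpr ⟨-s⁻¹ * r, ?_⟩)
      have h2 : r • u = -(s • v) := by linear_combination (norm := module) h
      rw [mul_smul, h2, neg_smul, smul_neg, neg_neg, inv_smul_smul₀ hs]
    subst hs
    exact ⟨by simpa [hw] using h, rfl, rfl⟩
  have hco := exists_coord_of_linearIndependent (a := u) (b := v) (c := w) hV (by
    rw [Fintype.linearIndependent_iff]
    intro g hg
    rw [Fin.sum_univ_three] at hg
    obtain ⟨h0, h1, h2⟩ := hzero _ _ _ hg
    intro i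
    fin_cases i
    · exact h0
    · exact h1
    · exact h2)
  have euv := hN.two_smul_apply_bracket u v
  have euw := hN.two_smul_apply_bracket u w
  have evw := hN.two_smul_apply_bracket v w
  rw [hNu, hNv, map_zero, map_zero, LinearMap.zero_apply, zero_add] at euv
  rw [hNu, ← hu, L.bracket_self, map_zero, LinearMap.zero_apply, zero_add] at euw
  rw [hNv, ← hu, map_zero, LinearMap.zero_apply, zero_add, L.bracket_skew v u] at evw
  obtain ⟨a, a', a'', huv⟩ := hco (L.bracket u v)
  obtain ⟨p, q, p'', huw⟩ := hco (L.bracket u w)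
  obtain ⟨b, c, c'', hvw⟩ := hco (L.bracket v w)
  rw [huv] at euv evw
  rw [huw] at euw
  rw [hvw] at evw
  simp only [map_add, map_smul, hNu, hNv, ← hu] at euv euw evw
  obtain ⟨f1, -, -⟩ := hzero (2 * a'') 0 0 (by linear_combination (norm := module) euv)
  have f1' : a'' = 0 := by simpa using f1
  subst f1'
  obtain ⟨g1, -, -⟩ := hzero (2 * p'') 0 0 (by linear_combination (norm := module) euw)
  have g1' : p'' = 0 := by simpa using g1
  subst g1'
  obtain ⟨k1, k2, -⟩ := hzero (2 * c'' + a) a' 0 (by linear_combination (norm := module) evw)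
  have k1' : c'' = -a / 2 := by linear_combination k1 / 2
  subst k1' k2
  have hq : q ≠ 0 := by
    rintro rfl
    refine hw (hL.eq_zero_of_line hV fun y => ?_)
    obtain ⟨r, s, t, rfl⟩ := hco y
    refine ⟨s * a + t * p, ?_⟩
    simp only [map_add, map_smul, L.bracket_self, huv, huw]
    module
  -- With `a = 0`, all brackets of `u, v, w` lie in the span of `u` and `v`, which is `ker N`.
  have ha : a ≠ 0 := by
    rintro rfl
    have hideal : L.IsIdeal (LinearMap.ker N) := by
      intro x hx y
      rw [LinearMap.mem_ker] at hx ⊢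
      obtain ⟨r, s, t, rfl⟩ := hco x
      obtain ⟨r', s', t', rfl⟩ := hco y
      have ht : t = 0 := by simpa [hNu, hNv, ← hu, hw] using hx
      subst ht
      simp only [map_add, map_smul, LinearMap.add_apply, LinearMap.smul_apply, L.bracket_self,
        L.bracket_skew v u, huv, huw, hvw, hNu, hNv, map_neg]
      simp
    rcases hL.2 _ hideal with h | h
    · have : u ∈ LinearMap.ker N := hNu
      rw [h] at this
      exact hw (by simpa using this)
    · have : w ∈ LinearMap.ker N := h ▸ Submodule.mem_top
      exact hw (by rw [hu]; exact this)
  refine isomorphic_algC_half hV (e := (-1 / a) • v) (u := u) (w := w) (b := -b / a) (c := c)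
    (p := p) (q := -(q * a)) hw (neg_ne_zero.mpr (mul_ne_zero hq ha)) ?_ ?_ ?_
  · rw [map_smul, LinearMap.smul_apply, L.bracket_skew, huv]
    match_scalars <;> field_simp <;> ring
  · rw [map_smul, LinearMap.smul_apply, hvw]
    match_scalars <;> field_simp
  · rw [huw]
    match_scalars <;> field_simp

theorem IsSimple.isomorphic_of_isNilpotent [FiniteDimensional ℂ V] {L : OmegaLieAlgebra V}
    (hL : L.IsSimple) {N : Module.End ℂ V} (hN : L.IsHalfDerivation N) (hnil : IsNilpotent N)
    (hN0 : N ≠ 0) : L.Isomorphic (algC (1 / 2)) ∨ L.Isomorphic (algC (-1 / 4)) := by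
  have h0 : L.omega ≠ 0 := fun h0 => hN0 (hN.eq_zero_of_isNilpotent hL h0 hnil)
  have hV : Module.finrank ℂ V = 3 := le_antisymm (hL.finrank_le_three h0) hL.three_le_finrank
  have hN3 : ∀ x, N (N (N x)) = 0 := by
    have h := LinearMap.aeval_self_charpoly N
    rw [IsNilpotent.charpoly_eq_X_pow_finrank hnil, hV] at h
    intro x
    have := LinearMap.congr_fun h x
    simpa [pow_succ] using this
  by_cases h : ∀ x, N (N x) = 0
  · left
    obtain ⟨w, hw⟩ : ∃ w, N w ≠ 0 := by
      by_contra! hc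
      exact hN0 (LinearMap.ext hc)
    exact hL.isomorphic_of_sq_eq_zero hV hN hw h
  · right
    push Not at h
    obtain ⟨z, hz⟩ := h
    exact hL.isomorphic_of_sq_ne_zero hV hN hz (hN3 z)

/-! ### ½-derivations and local ½-derivations of `C_{1/2}` and `C_{-1/4}` -/

theorem algC_bracket_apply (α : ℂ) (x y : Fin 3 → ℂ) :
    (algC α).bracket x y
      = ![x 1 * y 2 - x 2 * y 1, x 0 * y 1 - x 1 * y 0, α * (x 0 * y 2 - x 2 * y 0)] := rfl

theorem apply_eq_sum_three (D : (Fin 3 → ℂ) →ₗ[ℂ] (Fin 3 → ℂ)) (x : Fin 3 → ℂ) :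
    D x = x 0 • D ![1, 0, 0] + x 1 • D ![0, 1, 0] + x 2 • D ![0, 0, 1] := by
  rw [← map_smul, ← map_smul, ← map_smul, ← map_add, ← map_add]
  congr 1
  ext i
  fin_cases i <;> simp

/-- The matrix equations of a `½`-derivation of `C_α`. -/
theorem IsHalfDerivation.algC_equations {α : ℂ} {D : (Fin 3 → ℂ) →ₗ[ℂ] (Fin 3 → ℂ)}
    (hD : (algC α).IsHalfDerivation D) {A B C : Fin 3 → ℂ} (hA : D ![1, 0, 0] = A)
    (hB : D ![0, 1, 0] = B) (hC : D ![0, 0, 1] = C) :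
    (2 * B 0 = -A 2 ∧ 2 * B 1 = A 0 + B 1 ∧ 2 * B 2 = α * B 2) ∧
    (2 * α * C 0 = A 1 ∧ 2 * α * C 1 = C 1 ∧ 2 * α * C 2 = α * A 0 + α * C 2) ∧
    (2 * A 0 = B 1 + C 2 ∧ 2 * A 1 = -C 0 ∧ 2 * A 2 = α * B 0) := by
  have h1 := hD.two_smul_apply_bracket ![1, 0, 0] ![0, 1, 0]
  have h2 := hD.two_smul_apply_bracket ![1, 0, 0] ![0, 0, 1]
  have h3 := hD.two_smul_apply_bracket ![0, 1, 0] ![0, 0, 1]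
  have e2 : (![0, 0, α] : Fin 3 → ℂ) = α • ![0, 0, 1] := by simp
  simp only [algC_bracket_apply, Matrix.cons_val, mul_zero, mul_one, zero_mul, one_mul, sub_zero,
    zero_sub, sub_self, hA, hB, hC, e2, map_smul] at h1 h2 h3
  refine ⟨⟨?_, ?_, ?_⟩, ⟨?_, ?_, ?_⟩, ⟨?_, ?_, ?_⟩⟩
  · simpa using congrFun h1 0
  · simpa using congrFun h1 1
  · simpa using congrFun h1 2
  · simpa [mul_assoc] using congrFun h2 0
  · simpa [mul_assoc] using congrFun h2 1
  · simpa [mul_assoc] using congrFun h2 2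
  · simpa using congrFun h3 0
  · simpa using congrFun h3 1
  · simpa using congrFun h3 2

theorem algC_half_isHalfDerivation_of_forall {f : (Fin 3 → ℂ) →ₗ[ℂ] (Fin 3 → ℂ)} {d t : ℂ}
    (hf : ∀ x, f x = ![d * x 0, d * x 1 + t * x 2, d * x 2]) :
    (algC (1 / 2)).IsHalfDerivation f := by
  intro x y
  simp only [algC_bracket_apply, hf]
  ext i
  fin_cases i <;> simp <;> ring

theorem algC_neg_quarter_isHalfDerivation_of_forall {f : (Fin 3 → ℂ) →ₗ[ℂ] (Fin 3 → ℂ)}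
    {d t : ℂ} (hf : ∀ x, f x = ![d * x 0 + t * x 2, d * x 1 - t / 2 * x 0, d * x 2]) :
    (algC (-1 / 4)).IsHalfDerivation f := by
  intro x y
  simp only [algC_bracket_apply, hf]
  ext i
  fin_cases i <;> simp <;> ring

theorem IsHalfDerivation.algC_half_apply {D : (Fin 3 → ℂ) →ₗ[ℂ] (Fin 3 → ℂ)}
    (hD : (algC (1 / 2)).IsHalfDerivation D) :
    ∃ d t : ℂ, ∀ x, D x = ![d * x 0, d * x 1 + t * x 2, d * x 2] := by
  obtain ⟨⟨a1, a2, a3⟩, ⟨b1, b2, b3⟩, ⟨c1, c2, c3⟩⟩ := hD.algC_equations rfl rfl rfl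
  refine ⟨D ![1, 0, 0] 0, D ![0, 0, 1] 1, fun x => ?_⟩
  rw [apply_eq_sum_three]
  ext i
  fin_cases i <;> simp only [Pi.add_apply, Pi.smul_apply, smul_eq_mul, Fin.mk_zero, Fin.mk_one,
    Fin.reduceFinMk, Fin.isValue, Matrix.cons_val]
  · grind
  · grind
  · grind

theorem IsHalfDerivation.algC_neg_quarter_apply {D : (Fin 3 → ℂ) →ₗ[ℂ] (Fin 3 → ℂ)}
    (hD : (algC (-1 / 4)).IsHalfDerivation D) :
    ∃ d t : ℂ, ∀ x, D x = ![d * x 0 + t * x 2, d * x 1 - t / 2 * x 0, d * x 2] := by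
  obtain ⟨⟨a1, a2, a3⟩, ⟨b1, b2, b3⟩, ⟨c1, c2, c3⟩⟩ := hD.algC_equations rfl rfl rfl
  refine ⟨D ![1, 0, 0] 0, D ![0, 0, 1] 0, fun x => ?_⟩
  rw [apply_eq_sum_three]
  ext i
  fin_cases i <;> simp only [Pi.add_apply, Pi.smul_apply, smul_eq_mul, Fin.mk_zero, Fin.mk_one,
    Fin.reduceFinMk, Fin.isValue, Matrix.cons_val]
  · grind
  · grind
  · grind

theorem IsLocalHalfDerivation.isHalfDerivation_algC_half {f : (Fin 3 → ℂ) →ₗ[ℂ] (Fin 3 → ℂ)}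
    (hf : (algC (1 / 2)).IsLocalHalfDerivation f) : (algC (1 / 2)).IsHalfDerivation f := by
  have h : ∀ x, ∃ d t : ℂ, f x = ![d * x 0, d * x 1 + t * x 2, d * x 2] := by
    intro x
    obtain ⟨D, hD, hx⟩ := hf x
    obtain ⟨d, t, hdt⟩ := hD.algC_half_apply
    exact ⟨d, t, by rw [hx, hdt]⟩
  obtain ⟨d0, t0, h0⟩ := h ![1, 0, 0]
  obtain ⟨d1, t1, h1⟩ := h ![0, 1, 0]
  obtain ⟨d2, t2, h2⟩ := h ![0, 0, 1]
  obtain ⟨d3, t3, h3⟩ := h ![1, 1, 0]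
  obtain ⟨d4, t4, h4⟩ := h ![1, 0, 1]
  rw [apply_eq_sum_three, h0, h1, h2] at h3 h4
  have e1 := congrFun h3 0
  have e2 := congrFun h3 1
  have e3 := congrFun h4 0
  have e4 := congrFun h4 2
  simp at e1 e2 e3 e4
  refine algC_half_isHalfDerivation_of_forall (d := d0) (t := t2) fun x => ?_
  rw [apply_eq_sum_three, h0, h1, h2, e2, e4, ← e1, ← e3]
  ext i
  fin_cases i <;> simp <;> ring

theorem IsLocalHalfDerivation.isHalfDerivation_algC_neg_quarter
    {f : (Fin 3 → ℂ) →ₗ[ℂ] (Fin 3 → ℂ)} (hf : (algC (-1 / 4)).IsLocalHalfDerivation f) :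
    (algC (-1 / 4)).IsHalfDerivation f := by
  have h : ∀ x, ∃ d t : ℂ,
      f x = ![d * x 0 + t * x 2, d * x 1 - t / 2 * x 0, d * x 2] := by
    intro x
    obtain ⟨D, hD, hx⟩ := hf x
    obtain ⟨d, t, hdt⟩ := hD.algC_neg_quarter_apply
    exact ⟨d, t, by rw [hx, hdt]⟩
  obtain ⟨d0, t0, h0⟩ := h ![1, 0, 0]
  obtain ⟨d1, t1, h1⟩ := h ![0, 1, 0]
  obtain ⟨d2, t2, h2⟩ := h ![0, 0, 1]
  obtain ⟨d3, t3, h3⟩ := h ![0, 1, 1]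
  obtain ⟨d4, t4, h4⟩ := h ![1, 0, 1]
  -- The vector `(1, 0, 1)` yields only `d0 + t2 = d2 + t0`; a second ratio of coordinates separates
  -- `d0 = d2` from `t0 = t2`.
  obtain ⟨d5, t5, h5⟩ := h ![1, 0, 2]
  rw [apply_eq_sum_three, h0, h1, h2] at h3 h4 h5
  have e1 := congrFun h3 1
  have e2 := congrFun h3 2
  have e3 := congrFun h4 0
  have e4 := congrFun h4 1
  have e5 := congrFun h4 2
  have e6 := congrFun h5 0
  have e7 := congrFun h5 1
  have e8 := congrFun h5 2
  simp at e1 e2 e3 e4 e5 e6 e7 e8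
  obtain rfl : d1 = d2 := by rw [e1, e2]
  subst e4 e5 e7
  obtain rfl : d1 = d5 := by linear_combination e8 / 2
  obtain rfl : t0 = t2 := by linear_combination e3 - e6
  obtain rfl : d0 = d1 := by linear_combination e3
  refine algC_neg_quarter_isHalfDerivation_of_forall (d := d0) (t := t0) fun x => ?_
  rw [apply_eq_sum_three, h0, h1, h2]
  ext i
  fin_cases i <;> simp <;> ring

/-! ### Transport along isomorphisms and conclusion -/

theorem IsHalfDerivation.conj {L : OmegaLieAlgebra V} {M : OmegaLieAlgebra W} (e : V ≃ₗ[ℂ] W)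
    (he : ∀ x y, e (L.bracket x y) = M.bracket (e x) (e y)) {D : V →ₗ[ℂ] V}
    (hD : L.IsHalfDerivation D) : M.IsHalfDerivation (e.conj D) := by
  intro x y
  obtain ⟨x, rfl⟩ := e.surjective x
  obtain ⟨y, rfl⟩ := e.surjective y
  rw [← he x y]
  simp only [LinearEquiv.conj_apply_apply, LinearEquiv.symm_apply_apply, hD x y, map_smul,
    map_add]
  rw [he, he]

theorem IsLocalHalfDerivation.isHalfDerivation_of_isomorphic {L : OmegaLieAlgebra V}
    {M : OmegaLieAlgebra W} (hLM : L.Isomorphic M)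
    (hM : ∀ g, M.IsLocalHalfDerivation g → M.IsHalfDerivation g) {f : V →ₗ[ℂ] V}
    (hf : L.IsLocalHalfDerivation f) : L.IsHalfDerivation f := by
  obtain ⟨e, he, -⟩ := hLM
  have hloc : M.IsLocalHalfDerivation (e.conj f) := by
    intro x
    obtain ⟨D, hD, hx⟩ := hf (e.symm x)
    exact ⟨e.conj D, hD.conj e he, by simp only [LinearEquiv.conj_apply_apply, hx]⟩
  have he' : ∀ x y, e.symm (M.bracket x y) = L.bracket (e.symm x) (e.symm y) := by
    intro x y
    rw [LinearEquiv.symm_apply_eq, he]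
    simp
  have := (hM _ hloc).conj e.symm he'
  convert this using 1
  ext x
  simp

end OmegaLieAlgebra

open OmegaLieAlgebra in
theorem mainTheorem7 {V : Type*} [AddCommGroup V] [Module ℂ V] [FiniteDimensional ℂ V]
    (L : OmegaLieAlgebra V) (hL : L.IsSimple)
    (f : V →ₗ[ℂ] V) (hf : L.IsLocalHalfDerivation f) :
    L.IsHalfDerivation f ∧
      ((∃ c : ℂ, ∀ x, f x = c • x) ∨
        ∃ α ∈ ({2, 1 / 2, -4, -1 / 4} : Set ℂ), L.Isomorphic (OmegaLieAlgebra.algC α)) := by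
  by_cases h : ∃ N : Module.End ℂ V, L.IsHalfDerivation N ∧ IsNilpotent N ∧ N ≠ 0
  · obtain ⟨N, hN, hnil, hN0⟩ := h
    rcases hL.isomorphic_of_isNilpotent hN hnil hN0 with hiso | hiso
    · exact ⟨hf.isHalfDerivation_of_isomorphic hiso
        fun _ hg => hg.isHalfDerivation_algC_half, .inr ⟨1 / 2, by simp, hiso⟩⟩
    · exact ⟨hf.isHalfDerivation_of_isomorphic hiso
        fun _ hg => hg.isHalfDerivation_algC_neg_quarter, .inr ⟨-1 / 4, by simp, hiso⟩⟩
  -- Without nonzero nilpotent ½-derivations, each `D_x` is a scalar, depending on `x`; a linear map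
  -- with every vector an eigenvector is a single scalar.
  · have hscalar : ∀ x, ∃ c : ℂ, f x = c • x := by
      intro x
      obtain ⟨D, hD, hx⟩ := hf x
      obtain ⟨c, hc⟩ := IsHalfDerivation.exists_isNilpotent_sub hL (D := D) hD
      have h0 : D - c • (1 : Module.End ℂ V) = 0 := by
        by_contra hne
        exact h ⟨_, hD.sub_smul_one c, hc, hne⟩
      refine ⟨c, ?_⟩
      rw [hx, sub_eq_zero.mp h0]
      simp
    obtain ⟨c, hc⟩ := f.exists_eq_smul_id_of_forall_notLinearIndependent fun x hli => by
      obtain ⟨c, hc⟩ := hscalar x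
      rw [LinearIndependent.pair_iff] at hli
      have := (hli c (-1) (by rw [hc]; module)).2
      norm_num at this
    refine ⟨?_, .inl ⟨c, fun x => by rw [hc]; simp⟩⟩
    rw [hc]
    exact (isHalfDerivation_id L).smul c
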